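/- Let $(w_n)_{n\ge 1}$ be non-negative real numbers with $w_1>0$, and put $W_n=\sum_{i=1}^n w_i$ and $a_n=\sum_{i=1}^n w_i/W_i$. Let $(\mathtt T_n)_{n\ge1}$ be the weighted recursive tree with weights $(w_n)_{n\geq 1}$: $\mathtt T_1$ consists of the root, labelled $1$, and, for $n\ge1$, $\mathtt T_{n+1}$ is obtained from $\mathtt T_n$ by adding a vertex labelled $n+1$ whose parent is the vertex labelled $K_{n+1}\in\{1,\dots,n\}$, where $\mathbb P(K_{n+1}=k\mid \mathtt T_n)=w_k/W_n$ for $1\le k\le n$. Let $H(\mathtt T_n)$ be the height of $\mathtt T_n$, that is, the maximal distance of a vertex of $\mathtt T_n$ to the root. Let $\alpha>0$ and let $L\colon[1,\infty)\to(0,\infty)$ be twice differentiable with $xL'(x)/L(x)\to0$ and $x^2L''(x)/L(x)\to0$ as $x\to\infty$ (condition $(\mathrm{SV}_2)$). Assume that, as $n\to\infty$, $$a_n=\int_1^{\log n}x^{-\alpha}L(x)\,\mathrm dx+o\left((\log n)^{-1-\alpha}(\log\log n)^2L(\log n)\right)$$ and $$\sum_{i\ge n}\frac{w_i^2}{W_i^2}=O\left(\frac1n\right).$$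 Then, for all $n$ large enough, the series below converges, and almost surely, as $n\to\infty$, $$H(\mathtt T_n)=\frac{\log n}{\alpha\log\log n}+\frac{\log n}{(\alpha\log\log n)^2}\left(\sum_{k\ge0}\left(\frac{\log L(\log n)}{\alpha\log\log n}\right)^k\bigl[\log L(\log n)+(k+1)\log\log\log n\bigr]+1+\alpha+\log\alpha+o(1)\right).$$ -/

import Mathlib

open MeasureTheory ProbabilityTheory Filter Topology Asymptotics

noncomputable section

namespace WRT

/-- `W_n = w_1 + ⋯ + w_n`. Weights are indexed by `1, 2, 3, …`; the value `w 0` is never used. -/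
def totalWeight (w : ℕ → ℝ) (n : ℕ) : ℝ :=
  ∑ i ∈ Finset.Icc 1 n, w i

/-- `a_n = ∑_{i=1}^n w_i / W_i`. -/
def aSeq (w : ℕ → ℝ) (n : ℕ) : ℝ :=
  ∑ i ∈ Finset.Icc 1 n, w i / totalWeight w i

/-- The information contained in the labelled rooted tree `T_n` on the vertices `1, …, n` with
root `1`: it is generated by the labels `K_2, …, K_n` of the parents of the vertices `2, …, n`. -/
abbrev treeSigma {Ω : Type*} (K : ℕ → Ω → ℕ) (n : ℕ) : MeasurableSpace Ω :=
  ⨆ m ∈ Set.Icc 2 n, MeasurableSpace.comap (K m) ⊤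

/-- `K` is the sequence of parent labels of a weighted recursive tree with weights
`(w_n)_{n ≥ 1}`: the vertex `n + 1` is attached to the vertex `K (n + 1) ∈ {1, …, n}` of `T_n`,
and `P(K_{n+1} = k | T_n) = w_k / W_n` for `1 ≤ k ≤ n`. -/
structure IsWRT {Ω : Type*} [MeasurableSpace Ω] (μ : Measure Ω) (w : ℕ → ℝ)
    (K : ℕ → Ω → ℕ) : Prop where
  measurable_parent : ∀ n, 1 ≤ n → Measurable (K (n + 1))
  parent_mem : ∀ n, 1 ≤ n → ∀ ω, K (n + 1) ω ∈ Set.Icc 1 n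
  condProb_parent : ∀ n, 1 ≤ n → ∀ k ∈ Set.Icc 1 n,
    μ⟦K (n + 1) ⁻¹' {k} | treeSigma K n⟧ =ᵐ[μ] fun _ => w k / totalWeight w n

/-- Height of the vertex `m` in the rooted tree with root `1` and parent map `par`: the number of
steps from a vertex to its parent that lead from `m` to the root. -/
def vertexHeight (par : ℕ → ℕ) (m : ℕ) : ℕ :=
  sInf {j : ℕ | par^[j] m = 1}

/-- Height of the tree `T_n` on the vertices `1, …, n`. -/
def treeHeight (par : ℕ → ℕ) (n : ℕ) : ℕ :=
  (Finset.Icc 1 n).sup (vertexHeight par)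

/-- Condition `(SV_k)`, for `k ≥ 1`, on a function `L : [1, ∞) → (0, ∞)`: `L` is `k` times
differentiable on `[1, ∞)` (one-sided at `1`; the `k`-th derivative need not be continuous) and
`x ^ i * L^{(i)}(x) / L(x) → 0` as `x → ∞` for `1 ≤ i ≤ k`. -/
def SV (k : ℕ) (L : ℝ → ℝ) : Prop :=
  (∀ i < k, DifferentiableOn ℝ (iteratedDerivWithin i L (Set.Ici 1)) (Set.Ici 1)) ∧
  ∀ i ∈ Set.Icc 1 k,
    Tendsto (fun x : ℝ => x ^ i * iteratedDerivWithin i L (Set.Ici 1) x / L x) atTop (𝓝 0)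

/-- The `k`-th term
`(log L(log n) / (α log log n)) ^ k * (log L(log n) + (k + 1) log log log n)`
of the series in the expansion of the height. -/
def seriesTerm (α : ℝ) (L : ℝ → ℝ) (n k : ℕ) : ℝ :=
  (Real.log (L (Real.log n)) / (α * Real.log (Real.log n))) ^ k *
    (Real.log (L (Real.log n)) + ((k : ℝ) + 1) * Real.log (Real.log (Real.log n)))

end WRT

end

/-!
Write `x = log n` and `e^{-E(x)} = x^{-α} L(x)`, so that the labels in `(e^j, e^{j+1}]` carry the
mass `b_j ≈ e^{-E(j)}` of `∑ w_i / W_i`, and put `D(x) = E(x) - log log x - log α`. The height is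
`x / D(x) + (1 + α + o(1)) x / (α log x)²`, and expanding `x / D(x)` with a geometric series gives
the formula.

Upper bound: give the vertex with label `e^x` the cost `D(x)`. The exponential moment of the total
cost of a path to the root satisfies a linear recursion and is at most `exp (∑ e^{D} w_i / W_i)`,
where the sum is asymptotic to `x / (α log x)`. By Markov and Borel-Cantelli the path from any
vertex `e^x` costs at most `x + (1 + ε) x / (α log x)` up to a constant, and summation by parts
along the path turns this into a bound on its length.

Lower bound: let `Ψ(j, h)` be the total weight of the vertices of height at least `h` among the
first `e^j` labels. A truncated second-moment estimate and Borel-Cantelli show that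
`Ψ(j + 1, h + 1) ≥ Ψ(j, h + 1) + η b_j Ψ(j, h)` for a constant `η < 1` arbitrarily close to `1`, as
long as `Ψ(j, h) ≥ e^{-j + o(j)}`. Comparing with Pascal's recursion over blocks of `M (D - 1 + δ)`
windows, the height gains `M` per block, which adds up to the profile above.
-/

noncomputable section

namespace WRT

open Real (log exp)

/-- `E` is eventually differentiable and behaves like `α log` at the level of derivatives:
`t E'(t) → α`. With `L` slowly varying, `α log - log L` is the example that matters. -/
structure LogLike (α : ℝ) (E : ℝ → ℝ) : Prop where
  differentiable : ∀ᶠ t in atTop, DifferentiableAt ℝ E t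
  tendsto_deriv : Tendsto (fun t => t * deriv E t) atTop (𝓝 α)

section LogLike

variable {α β : ℝ} {E F : ℝ → ℝ}

lemma logLike_const (c : ℝ) : LogLike 0 (fun _ => c) :=
  ⟨Eventually.of_forall fun _ => by fun_prop, by simp⟩

lemma logLike_mul_log (α : ℝ) : LogLike α (fun x => α * log x) := by
  refine ⟨?_, tendsto_const_nhds.congr' ?_⟩ <;> filter_upwards [eventually_gt_atTop 0] with t ht
  · exact (Real.differentiableAt_log ht.ne').const_mul α
  · rw [deriv_const_mul α (Real.differentiableAt_log ht.ne'), Real.deriv_log]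
    field_simp

lemma logLike_log_log : LogLike 0 (fun x => log (log x)) := by
  have hasDerivAt_log_log : ∀ t : ℝ, 1 < t →
      HasDerivAt (fun x => log (log x)) (t⁻¹ / log t) t := fun t ht =>
    (Real.hasDerivAt_log (by positivity)).log (Real.log_pos ht).ne'
  refine ⟨?_, (tendsto_inv_atTop_zero.comp Real.tendsto_log_atTop).congr' ?_⟩ <;>
    filter_upwards [eventually_gt_atTop 1] with t ht
  · exact (hasDerivAt_log_log t ht).differentiableAt
  · rw [(hasDerivAt_log_log t ht).deriv, Function.comp]
    field_simp

namespace LogLike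

lemma sub (hE : LogLike α E) (hF : LogLike β F) : LogLike (α - β) (fun x => E x - F x) := by
  refine ⟨?_, (hE.tendsto_deriv.sub hF.tendsto_deriv).congr' ?_⟩ <;>
    filter_upwards [hE.differentiable, hF.differentiable] with t hEt hFt
  · exact hEt.sub hFt
  · rw [deriv_fun_sub hEt hFt]
    ring

lemma const_mul (hE : LogLike α E) (c : ℝ) : LogLike (c * α) (fun x => c * E x) := by
  refine ⟨?_, (hE.tendsto_deriv.const_mul c).congr' ?_⟩ <;>
    filter_upwards [hE.differentiable] with t hEt
  · exact hEt.const_mul c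
  · rw [deriv_const_mul c hEt]
    ring

lemma eventually_abs_sub_le (hE : LogLike α E) {C : ℝ} (hC : |α| < C) :
    ∀ᶠ x in atTop, ∀ t, x ≤ t → |E t - E x| ≤ C * (t - x) / x := by
  have hderiv : ∀ᶠ t in atTop, |t * deriv E t| < C := hE.tendsto_deriv.abs.eventually_lt_const hC
  obtain ⟨X, hX⟩ :=
    (hderiv.and (hE.differentiable.and (eventually_gt_atTop 0))).exists_forall_of_atTop
  filter_upwards [eventually_ge_atTop X] with x hx t ht
  have hx0 : 0 < x := (hX x hx).2.2
  have deriv_le : ∀ y ∈ Set.Ici x, ‖deriv E y‖ ≤ C / x := by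
    intro y hy
    have hyC := (hX y (hx.trans hy)).1.le
    rw [abs_mul, abs_of_pos (hx0.trans_le hy)] at hyC
    rw [Real.norm_eq_abs, le_div_iff₀' hx0]
    exact (mul_le_mul_of_nonneg_right hy (abs_nonneg _)).trans hyC
  calc |E t - E x|
      ≤ C / x * |t - x| := (convex_Ici x).norm_image_sub_le_of_norm_deriv_le
        (fun y hy => (hX y (hx.trans hy)).2.1) deriv_le Set.self_mem_Ici (Set.mem_Ici.2 ht)
    _ = C * (t - x) / x := by rw [abs_of_nonneg (sub_nonneg.2 ht), div_mul_eq_mul_div]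

lemma eventually_monotoneOn (hE : LogLike α E) (hα : 0 < α) :
    ∀ᶠ X in atTop, MonotoneOn E (Set.Ici X) := by
  have hderiv : ∀ᶠ t in atTop, 0 < t * deriv E t := hE.tendsto_deriv.eventually_const_lt hα
  obtain ⟨X₀, hX₀⟩ :=
    (hderiv.and (hE.differentiable.and (eventually_gt_atTop 0))).exists_forall_of_atTop
  filter_upwards [eventually_ge_atTop X₀] with X hX
  refine monotoneOn_of_deriv_nonneg (convex_Ici X)
    (fun t ht => (hX₀ t (hX.trans ht)).2.1.continuousAt.continuousWithinAt)
    (fun t ht => (hX₀ t (hX.trans (interior_subset ht))).2.1.differentiableWithinAt)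
    (fun t ht => ?_)
  obtain ⟨hpos, -, ht0⟩ := hX₀ t (hX.trans (interior_subset ht))
  exact (pos_of_mul_pos_right hpos ht0.le).le

lemma eventually_div_log_lt {c : ℝ} (hE : LogLike α E) (hc : α < c) :
    ∀ᶠ t in atTop, E t / log t < c := by
  obtain ⟨d, hαd, hdc⟩ := exists_between hc
  obtain ⟨X, hX⟩ := (((logLike_mul_log d).sub hE).eventually_monotoneOn (sub_pos.2 hαd)).exists
  have hlim : Tendsto (fun t => d + (E X - d * log X) / log t) atTop (𝓝 (d + 0)) :=
    (tendsto_const_nhds.div_atTop Real.tendsto_log_atTop).const_add d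
  rw [add_zero] at hlim
  filter_upwards [hlim.eventually_lt_const hdc, eventually_ge_atTop X, eventually_gt_atTop 1]
    with t hlt hXt ht
  refine lt_of_le_of_lt ?_ hlt
  have hlog := Real.log_pos ht
  rw [div_le_iff₀ hlog, add_mul, div_mul_cancel₀ _ hlog.ne']
  linarith [show d * log X - E X ≤ d * log t - E t from hX Set.self_mem_Ici hXt hXt]

lemma tendsto_div_log (hE : LogLike α E) : Tendsto (fun t => E t / log t) atTop (𝓝 α) := by
  refine tendsto_order.2 ⟨fun c hc => ?_, fun c hc => hE.eventually_div_log_lt hc⟩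
  filter_upwards [((logLike_const 0).sub hE).eventually_div_log_lt (c := -c) (by linarith)]
    with t ht
  rw [zero_sub, neg_div] at ht
  linarith

lemma tendsto_atTop (hE : LogLike α E) (hα : 0 < α) : Tendsto E atTop atTop := by
  refine (hE.tendsto_div_log.pos_mul_atTop hα Real.tendsto_log_atTop).congr' ?_
  filter_upwards [eventually_gt_atTop 1] with t ht
  rw [div_mul_cancel₀ _ (Real.log_pos ht).ne']

lemma tendsto_div_mul_log (hE : LogLike α E) (hα : 0 < α) :
    Tendsto (fun t => E t / (α * log t)) atTop (𝓝 1) := by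
  have hlim := hE.tendsto_div_log.div_const α
  rw [div_self hα.ne'] at hlim
  exact hlim.congr fun t => by rw [div_div, mul_comm]

lemma tendsto_mul_log_div (hE : LogLike α E) (hα : 0 < α) :
    Tendsto (fun t => α * log t / E t) atTop (𝓝 1) := by
  simpa using (hE.tendsto_div_mul_log hα).inv₀ one_ne_zero

end LogLike

end LogLike

/-! ### The height profile -/

/-- With `e^{-E}` the density of `a_n` in the variable `x = log n`, this is the logarithm of
`e^{E(x)} / (α log x)`, the factor by which the upper bound tilts the vertices with label `e^x`. -/
def cost (α : ℝ) (E : ℝ → ℝ) (x : ℝ) : ℝ := E x - log (log x) - log α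

/-- The height profile `x / D(x) + (1 + α + c) x / (α log x)²`, where `D` is `cost α E`. The height
of `T_n` is `profile α E 0 (log n)` up to `o(log n / (log log n)²)`; the slack is `c`. -/
def profile (α : ℝ) (E : ℝ → ℝ) (c x : ℝ) : ℝ :=
  x / cost α E x + (1 + α + c) * (x / (α * log x) ^ 2)

/-- The barrier `x + (1 + ε) x / (α log x)`, which bounds the total cost along the path from the
vertex labelled `e^x` to the root. -/
def barrier (α ε x : ℝ) : ℝ := x + (1 + ε) * (x / (α * log x))

section Profile

variable {α : ℝ} {E : ℝ → ℝ}

lemma tendsto_mul_log_atTop (hα : 0 < α) : Tendsto (fun t => α * log t) atTop atTop :=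
  Real.tendsto_log_atTop.const_mul_atTop hα

lemma tendsto_one_div_log : Tendsto (fun t => 1 / log t) atTop (𝓝 0) :=
  tendsto_const_nhds.div_atTop Real.tendsto_log_atTop

lemma hasDerivAt_div_mul_log (hα : 0 < α) {t : ℝ} (ht : 1 < t) :
    HasDerivAt (fun x => x / (α * log x)) ((1 - 1 / log t) / (α * log t)) t := by
  have hlog := Real.log_pos ht
  refine ((hasDerivAt_id t).div ((Real.hasDerivAt_log (by positivity : t ≠ 0)).const_mul α)
    (by positivity)).congr_deriv ?_
  simp only [id]
  field_simp

lemma hasDerivAt_div_mul_log_sq (hα : 0 < α) {t : ℝ} (ht : 1 < t) :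
    HasDerivAt (fun x => x / (α * log x) ^ 2) ((1 - 2 / log t) / (α * log t) ^ 2) t := by
  have hlog := Real.log_pos ht
  refine ((hasDerivAt_id t).div (((Real.hasDerivAt_log (by positivity : t ≠ 0)).const_mul α).pow 2)
    (pow_pos (mul_pos hα hlog) 2).ne').congr_deriv ?_
  simp only [id, Pi.pow_apply]
  field_simp
  ring

lemma hasDerivAt_barrier (hα : 0 < α) (ε : ℝ) {t : ℝ} (ht : 1 < t) :
    HasDerivAt (barrier α ε) (1 + (1 + ε) * ((1 - 1 / log t) / (α * log t))) t :=
  (hasDerivAt_id t).add ((hasDerivAt_div_mul_log hα ht).const_mul (1 + ε))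

lemma tendsto_deriv_barrier (hα : 0 < α) (ε : ℝ) :
    Tendsto (deriv (barrier α ε)) atTop (𝓝 1) := by
  have hlim : Tendsto (fun t => 1 + (1 + ε) * ((1 - 1 / log t) / (α * log t))) atTop
      (𝓝 (1 + (1 + ε) * 0)) :=
    (((tendsto_one_div_log.const_sub 1).div_atTop (tendsto_mul_log_atTop hα)).const_mul
      (1 + ε)).const_add 1
  rw [mul_zero, add_zero] at hlim
  refine hlim.congr' ?_
  filter_upwards [eventually_gt_atTop 1] with t ht using (hasDerivAt_barrier hα ε ht).deriv.symm

namespace LogLike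

lemma logLike_cost (hE : LogLike α E) : LogLike α (cost α E) := by
  have h := (hE.sub logLike_log_log).sub (logLike_const (log α))
  rwa [sub_zero, sub_zero] at h

lemma eventually_hasDerivAt_profile (hE : LogLike α E) (hα : 0 < α) (c : ℝ) :
    ∀ᶠ t in atTop, HasDerivAt (profile α E c)
      ((cost α E t - t * deriv (cost α E) t) / cost α E t ^ 2 +
        (1 + α + c) * ((1 - 2 / log t) / (α * log t) ^ 2)) t := by
  filter_upwards [eventually_gt_atTop 1, hE.logLike_cost.differentiable,
    (hE.logLike_cost.tendsto_atTop hα).eventually_gt_atTop 0] with t ht hdiff hpos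
  refine HasDerivAt.add ?_ ((hasDerivAt_div_mul_log_sq hα ht).const_mul (1 + α + c))
  exact ((hasDerivAt_id t).div hdiff.hasDerivAt hpos.ne').congr_deriv (by simp)

lemma tendsto_deriv_profile_sub (hE : LogLike α E) (hα : 0 < α) (c : ℝ) :
    Tendsto (fun t => (deriv (profile α E c) t - 1 / cost α E t) * (α * log t) ^ 2)
      atTop (𝓝 (1 + c)) := by
  have hlim : Tendsto (fun t => -(t * deriv (cost α E) t) * (α * log t / cost α E t) ^ 2 +
      (1 + α + c) * (1 - 2 * (1 / log t))) atTop
      (𝓝 (-α * 1 ^ 2 + (1 + α + c) * (1 - 2 * 0))) :=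
    (hE.logLike_cost.tendsto_deriv.neg.mul ((hE.logLike_cost.tendsto_mul_log_div hα).pow 2)).add
      (((tendsto_one_div_log.const_mul 2).const_sub 1).const_mul (1 + α + c))
  rw [show -α * 1 ^ 2 + (1 + α + c) * (1 - 2 * 0) = 1 + c by ring] at hlim
  refine hlim.congr' ?_
  filter_upwards [eventually_gt_atTop 1, hE.eventually_hasDerivAt_profile hα c,
    (hE.logLike_cost.tendsto_atTop hα).eventually_gt_atTop 0] with t ht hderiv hpos
  rw [hderiv.deriv]
  have hlog := Real.log_pos ht
  field_simp
  ring

lemma tendsto_deriv_barrier_div_cost_sub (hE : LogLike α E) (hα : 0 < α) (ε : ℝ) :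
    Tendsto (fun t => (deriv (barrier α ε) t / cost α E t - 1 / cost α E t) * (α * log t) ^ 2)
      atTop (𝓝 (1 + ε)) := by
  have hlim : Tendsto (fun t => (1 + ε) * ((1 - 1 / log t) * (α * log t / cost α E t))) atTop
      (𝓝 ((1 + ε) * ((1 - 0) * 1))) :=
    ((tendsto_one_div_log.const_sub 1).mul
      (hE.logLike_cost.tendsto_mul_log_div hα)).const_mul (1 + ε)
  rw [sub_zero, one_mul, mul_one] at hlim
  refine hlim.congr' ?_
  filter_upwards [eventually_gt_atTop 1,
    (hE.logLike_cost.tendsto_atTop hα).eventually_gt_atTop 0] with t ht hpos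
  rw [(hasDerivAt_barrier hα ε ht).deriv]
  have hlog := Real.log_pos ht
  field_simp
  ring

lemma eventually_deriv_barrier_div_cost_le (hE : LogLike α E) (hα : 0 < α) {ε c : ℝ}
    (hεc : ε < c) :
    ∀ᶠ t in atTop, deriv (barrier α ε) t / cost α E t ≤ deriv (profile α E c) t := by
  have hlim := (hE.tendsto_deriv_profile_sub hα c).sub (hE.tendsto_deriv_barrier_div_cost_sub hα ε)
  filter_upwards [hlim.eventually_const_lt (show (0 : ℝ) < 1 + c - (1 + ε) by linarith)] with t ht
  rw [← sub_mul] at ht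
  linarith [pos_of_mul_pos_left ht (sq_nonneg _)]

lemma eventually_sub_barrier_div_cost_le (hE : LogLike α E) (hα : 0 < α) {ε c : ℝ}
    (hεc : ε < c) :
    ∀ᶠ X in atTop, ∀ x y, X ≤ x → x ≤ y →
      (barrier α ε y - barrier α ε x) / cost α E y ≤ profile α E c y - profile α E c x := by
  obtain ⟨X₀, hX₀⟩ := ((hE.eventually_deriv_barrier_div_cost_le hα hεc).and
    ((hE.eventually_hasDerivAt_profile hα c).and
    (((tendsto_deriv_barrier hα ε).eventually_const_lt one_pos).and
    (((hE.logLike_cost.tendsto_atTop hα).eventually_gt_atTop 0).and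
    (eventually_gt_atTop 1))))).exists_forall_of_atTop
  filter_upwards [eventually_ge_atTop X₀, hE.logLike_cost.eventually_monotoneOn hα]
    with X hX hmono x y hx hxy
  have hX₀_le : ∀ t ∈ Set.Icc x y, X₀ ≤ t := fun t ht => hX.trans (hx.trans ht.1)
  have hasDerivAt_diff : ∀ t ∈ Set.Icc x y,
      HasDerivAt (fun t => profile α E c t - barrier α ε t / cost α E y)
      (deriv (profile α E c) t - deriv (barrier α ε) t / cost α E y) t := fun t ht => by
    obtain ⟨-, hprofile, -, -, ht1⟩ := hX₀ t (hX₀_le t ht)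
    exact hprofile.differentiableAt.hasDerivAt.sub
      ((hasDerivAt_barrier hα ε ht1).differentiableAt.hasDerivAt.div_const _)
  have monotoneOn_diff : MonotoneOn
      (fun t => profile α E c t - barrier α ε t / cost α E y) (Set.Icc x y) := by
    refine monotoneOn_of_deriv_nonneg (convex_Icc x y)
      (fun t ht => (hasDerivAt_diff t ht).continuousAt.continuousWithinAt)
      (fun t ht => (hasDerivAt_diff t (interior_subset ht)).differentiableAt.differentiableWithinAt)
      (fun t ht => ?_)
    have ht' := interior_subset ht
    obtain ⟨hle, -, hbarrier, hcost, -⟩ := hX₀ t (hX₀_le t ht')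
    have cost_le : cost α E t ≤ cost α E y := hmono (hx.trans ht'.1) (hx.trans hxy) ht'.2
    rw [(hasDerivAt_diff t ht').deriv, sub_nonneg]
    exact (div_le_div_of_nonneg_left hbarrier.le hcost cost_le).trans hle
  have hle : profile α E c x - barrier α ε x / cost α E y ≤
      profile α E c y - barrier α ε y / cost α E y :=
    monotoneOn_diff (Set.left_mem_Icc.2 hxy) (Set.right_mem_Icc.2 hxy) hxy
  rw [sub_div]
  linarith

lemma eventually_monotoneOn_profile (hE : LogLike α E) (hα : 0 < α) {c : ℝ} (hc : -1 < c) :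
    ∀ᶠ X in atTop, MonotoneOn (profile α E c) (Set.Ici X) := by
  have hexcess :=
    (hE.tendsto_deriv_profile_sub hα c).eventually_const_lt (show (0 : ℝ) < 1 + c by linarith)
  obtain ⟨X₀, hX₀⟩ := (hexcess.and ((hE.eventually_hasDerivAt_profile hα c).and
    ((hE.logLike_cost.tendsto_atTop hα).eventually_gt_atTop 0))).exists_forall_of_atTop
  filter_upwards [eventually_ge_atTop X₀] with X hX
  refine monotoneOn_of_deriv_nonneg (convex_Ici X)
    (fun t ht => (hX₀ t (hX.trans ht)).2.1.continuousAt.continuousWithinAt)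
    (fun t ht => (hX₀ t (hX.trans
      (interior_subset ht))).2.1.differentiableAt.differentiableWithinAt) (fun t ht => ?_)
  obtain ⟨hpos, -, hcost⟩ := hX₀ t (hX.trans (interior_subset ht))
  linarith [pos_of_mul_pos_left hpos (sq_nonneg _), one_div_pos.2 hcost]

end LogLike

lemma tendsto_div_mul_log_sq_atTop (hα : 0 < α) :
    Tendsto (fun x => x / (α * log x) ^ 2) atTop atTop := by
  have hzero : Tendsto (fun x => log x ^ 2 / x) atTop (𝓝[>] 0) := by
    refine tendsto_nhdsWithin_iff.2
      ⟨(Real.isLittleO_pow_log_id_atTop (n := 2)).tendsto_div_nhds_zero, ?_⟩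
    filter_upwards [eventually_gt_atTop 1] with x hx
    have hlog := Real.log_pos hx
    exact Set.mem_Ioi.2 (by positivity)
  refine ((tendsto_inv_nhdsGT_zero.comp hzero).const_mul_atTop
    (show 0 < (α ^ 2)⁻¹ by positivity)).congr fun x => ?_
  simp only [Function.comp, inv_div]
  rw [mul_pow, div_mul_eq_div_div_swap, inv_mul_eq_div]

lemma eventually_profile_add_le (hα : 0 < α) {c c' : ℝ} (hc : c < c') (B : ℝ) :
    ∀ᶠ x in atTop, profile α E c x + B ≤ profile α E c' x := by
  filter_upwards
    [((tendsto_div_mul_log_sq_atTop hα).const_mul_atTop (sub_pos.2 hc)).eventually_ge_atTop B]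
    with x hx
  unfold profile
  linarith

end Profile

/-! ### Heights of recursive trees -/

/-- `par` is the parent map of a recursive tree rooted at `1`: the parent of a vertex has a smaller
label. -/
def IsParentMap (par : ℕ → ℕ) : Prop := ∀ n, 1 ≤ n → par (n + 1) ∈ Set.Icc 1 n

/-- Sum of `f` along the path from `m` to the root, the root being excluded. -/
def pathSum (f : ℕ → ℝ) (par : ℕ → ℕ) (m : ℕ) : ℝ :=
  ∑ j ∈ Finset.range (vertexHeight par m), f (par^[j] m)

@[simp] lemma vertexHeight_one (par : ℕ → ℕ) : vertexHeight par 1 = 0 :=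
  Nat.sInf_eq_zero.2 (Or.inl rfl)

@[simp] lemma pathSum_one (f : ℕ → ℝ) (par : ℕ → ℕ) : pathSum f par 1 = 0 := by
  simp [pathSum]

lemma pathSum_const_one (par : ℕ → ℕ) (m : ℕ) :
    pathSum (fun _ => 1) par m = vertexHeight par m := by
  simp [pathSum]

namespace IsParentMap

variable {par : ℕ → ℕ} {m : ℕ}

lemma one_le (hp : IsParentMap par) (hm : 2 ≤ m) : 1 ≤ par m := by
  obtain ⟨n, rfl⟩ : ∃ n, m = n + 1 := ⟨m - 1, by omega⟩
  exact (hp n (by omega)).1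

lemma lt (hp : IsParentMap par) (hm : 2 ≤ m) : par m < m := by
  obtain ⟨n, rfl⟩ : ∃ n, m = n + 1 := ⟨m - 1, by omega⟩
  exact Nat.lt_succ_of_le (hp n (by omega)).2

lemma induction_on (hp : IsParentMap par) {P : ℕ → Prop} (root : P 1)
    (child : ∀ m, 2 ≤ m → P (par m) → P m) (hm : 1 ≤ m) : P m := by
  induction m using Nat.strong_induction_on with
  | _ m ih =>
    rcases hm.eq_or_lt with rfl | hm2
    · exact root
    · exact child m hm2 (ih _ (hp.lt hm2) (hp.one_le hm2))

lemma exists_iterate_eq_one (hp : IsParentMap par) (hm : 1 ≤ m) : ∃ j, par^[j] m = 1 :=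
  hp.induction_on (P := fun m => ∃ j, par^[j] m = 1) ⟨0, rfl⟩
    (fun m _ ⟨j, hj⟩ => ⟨j + 1, by rwa [Function.iterate_succ_apply]⟩) hm

lemma vertexHeight_eq (hp : IsParentMap par) (hm : 2 ≤ m) :
    vertexHeight par m = vertexHeight par (par m) + 1 := by
  have hmem : par^[sInf {j : ℕ | par^[j] m = 1}] m = 1 :=
    Nat.sInf_mem (s := {j : ℕ | par^[j] m = 1}) (hp.exists_iterate_eq_one (by omega))
  have hpos : 1 ≤ sInf {j : ℕ | par^[j] m = 1} := by
    refine Nat.one_le_iff_ne_zero.2 fun h => ?_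
    rw [h, Function.iterate_zero_apply] at hmem
    omega
  exact (Nat.sInf_add hpos).symm

lemma pathSum_eq (hp : IsParentMap par) (f : ℕ → ℝ) (hm : 2 ≤ m) :
    pathSum f par m = f m + pathSum f par (par m) := by
  rw [pathSum, hp.vertexHeight_eq hm, Finset.sum_range_succ', add_comm]
  simp [pathSum, Function.iterate_succ_apply]

lemma vertexHeight_lt (hp : IsParentMap par) (hm : 1 ≤ m) : vertexHeight par m < m :=
  hp.induction_on (P := fun m => vertexHeight par m < m) (by simp)
    (fun m hm2 ih => by
      have := hp.lt hm2
      rw [hp.vertexHeight_eq hm2]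
      omega) hm

lemma pathSum_indicator_Ioi_of_le (hp : IsParentMap par) {n₀ : ℕ} (D : ℕ → ℝ) (hm : 1 ≤ m)
    (hmn : m ≤ n₀) : pathSum ((Set.Ioi n₀).indicator D) par m = 0 :=
  hp.induction_on (P := fun m => m ≤ n₀ → pathSum ((Set.Ioi n₀).indicator D) par m = 0) (by simp)
    (fun m hm2 ih hmn => by
      rw [hp.pathSum_eq _ hm2, ih ((hp.lt hm2).le.trans hmn),
        Set.indicator_of_notMem (Set.notMem_Ioi.2 hmn), add_zero]) hm hmn

-- Abel summation along the path: the quantity that decreases towards the root is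
-- `vertexHeight m + (g m - pathSum m) / D m`.
lemma vertexHeight_le_of_pathSum_le (hp : IsParentMap par) {D g u : ℕ → ℝ} {n₀ : ℕ}
    (hn₀ : 1 ≤ n₀) (hD_pos : 0 < D n₀) (hD : MonotoneOn D (Set.Ici n₀))
    (hgu : ∀ k m, n₀ ≤ k → k ≤ m → (g m - g k) / D m ≤ u m - u k)
    (hS : ∀ m, n₀ < m → pathSum ((Set.Ioi n₀).indicator D) par m ≤ g m) (hm : n₀ < m) :
    (vertexHeight par m : ℝ) ≤ u m + (n₀ - u n₀ + |g n₀| / D n₀) := by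
  have D_pos : ∀ k, n₀ ≤ k → 0 < D k := fun k hk => hD_pos.trans_le (hD Set.self_mem_Ici hk hk)
  suffices H : vertexHeight par m + (g m - pathSum ((Set.Ioi n₀).indicator D) par m) / D m ≤
      u m + (n₀ - u n₀ + |g n₀| / D n₀) by
    linarith [div_nonneg (sub_nonneg.2 (hS m hm)) (D_pos m hm.le).le]
  induction m using Nat.strong_induction_on with
  | _ m ih =>
    have hm2 : 2 ≤ m := by omega
    have hDm := D_pos m hm.le
    have expand : ∀ S : ℝ, (g m - (D m + S)) / D m = (g m - S) / D m - 1 := fun S => by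
      rw [← sub_sub, sub_right_comm, sub_div _ (D m), div_self hDm.ne']
    rw [hp.pathSum_eq _ hm2, hp.vertexHeight_eq hm2, Set.indicator_of_mem (Set.mem_Ioi.2 hm),
      expand]
    push_cast
    rcases le_or_gt (par m) n₀ with hk | hk
    · rw [hp.pathSum_indicator_Ioi_of_le D (hp.one_le hm2) hk, sub_zero]
      have height_le : (vertexHeight par (par m) : ℝ) ≤ n₀ := by
        exact_mod_cast (hp.vertexHeight_lt (hp.one_le hm2)).le.trans hk
      have base_le : g n₀ / D m ≤ |g n₀| / D n₀ :=
        div_le_div₀ (abs_nonneg _) (le_abs_self _) hD_pos (hD Set.self_mem_Ici hm.le hm.le)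
      have step_le := hgu n₀ m le_rfl hm.le
      rw [sub_div] at step_le
      linarith
    · have hkm := (hp.lt hm2).le
      have step_le := hgu _ m hk.le hkm
      have slack_le := div_le_div_of_nonneg_left (sub_nonneg.2 (hS _ hk)) (D_pos _ hk.le)
        (hD hk.le hm.le hkm)
      rw [sub_div] at step_le slack_le ⊢
      linarith [ih _ (hp.lt hm2) hk]

lemma treeHeight_le_of_vertexHeight_le (hp : IsParentMap par) {u : ℕ → ℝ} {n₀ n : ℕ} {B : ℝ}
    (hn₀ : 1 ≤ n₀) (hn : n₀ ≤ n) (hu : MonotoneOn u (Set.Ici n₀))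
    (hB : ∀ m, n₀ < m → (vertexHeight par m : ℝ) ≤ u m + B) :
    (treeHeight par n : ℝ) ≤ u n + max B (n₀ - u n₀) := by
  obtain ⟨m, hm, hsup⟩ := Finset.exists_mem_eq_sup (Finset.Icc 1 n)
    (Finset.nonempty_Icc.2 (hn₀.trans hn)) (vertexHeight par)
  rw [Finset.mem_Icc] at hm
  rw [treeHeight, hsup]
  rcases le_or_gt m n₀ with hmn₀ | hmn₀
  · have height_le : (vertexHeight par m : ℝ) ≤ n₀ := by
      exact_mod_cast (hp.vertexHeight_lt hm.1).le.trans hmn₀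
    linarith [hu Set.self_mem_Ici hn hn, le_max_right B (n₀ - u n₀)]
  · linarith [hB m hmn₀, hu hmn₀.le hn hm.2, le_max_left B (n₀ - u n₀)]

end IsParentMap

/-- The cost of a vertex with label `i`, namely the cost at `log i` if `i > n₀` and `0` for the
first `n₀` labels, where `cost` need not be positive. -/
def labelCost (α : ℝ) (E : ℝ → ℝ) (n₀ : ℕ) : ℕ → ℝ :=
  (Set.Ioi n₀).indicator fun i => cost α E (log i)

lemma tendsto_log_natCast : Tendsto (fun n : ℕ => log n) atTop atTop :=
  Real.tendsto_log_atTop.comp tendsto_natCast_atTop_atTop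

lemma monotoneOn_comp_log_natCast {f : ℝ → ℝ} {n₀ : ℕ} (hn₀ : 1 ≤ n₀)
    (hf : MonotoneOn f (Set.Ici (log n₀))) :
    MonotoneOn (fun n : ℕ => f (log n)) (Set.Ici n₀) := by
  have log_le_log : ∀ {k m : ℕ}, n₀ ≤ k → k ≤ m → log k ≤ log m := fun {k m} hk hkm =>
    Real.log_le_log (by exact_mod_cast hn₀.trans hk) (by exact_mod_cast hkm)
  exact fun k hk m hm hkm => hf (log_le_log le_rfl hk) (log_le_log le_rfl hm) (log_le_log hk hkm)

lemma LogLike.eventually_treeHeight_le {α : ℝ} {E : ℝ → ℝ} (hE : LogLike α E) (hα : 0 < α)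
    {ε c : ℝ} (hε : 0 < ε) (hεc : ε < c) :
    ∀ᶠ n₀ : ℕ in atTop, ∀ par, IsParentMap par → ∀ C,
      (∀ m, n₀ < m → pathSum (labelCost α E n₀) par m ≤ barrier α ε (log m) + C) →
      ∀ᶠ n : ℕ in atTop, (treeHeight par n : ℝ) ≤ profile α E c (log n) := by
  obtain ⟨c', hεc', hc'c⟩ := exists_between hεc
  filter_upwards [tendsto_log_natCast.eventually (hE.eventually_sub_barrier_div_cost_le hα hεc'),
    tendsto_log_natCast.eventually (hE.eventually_monotoneOn_profile hα (c := c') (by linarith)),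
    tendsto_log_natCast.eventually (hE.logLike_cost.eventually_monotoneOn hα),
    tendsto_log_natCast.eventually ((hE.logLike_cost.tendsto_atTop hα).eventually_gt_atTop 0),
    eventually_ge_atTop 1]
    with n₀ increment_le profile_mono cost_mono cost_pos hn₀ par hp C hC
  have log_mono : MonotoneOn (fun n : ℕ => log n) (Set.Ici n₀) :=
    monotoneOn_comp_log_natCast hn₀ monotoneOn_id
  have vertexHeight_le : ∀ m, n₀ < m →
      (vertexHeight par m : ℝ) ≤ profile α E c' (log m) + _ := fun m hm =>
    hp.vertexHeight_le_of_pathSum_le (D := fun m => cost α E (log m))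
      (g := fun m => barrier α ε (log m) + C) (u := fun m => profile α E c' (log m)) hn₀ cost_pos
      (monotoneOn_comp_log_natCast hn₀ cost_mono)
      (fun k m hk hkm => by
        rw [add_sub_add_right_eq_sub]
        exact increment_le _ _ (log_mono Set.self_mem_Ici hk hk) (log_mono hk (hk.trans hkm) hkm))
      hC hm
  filter_upwards [tendsto_log_natCast.eventually (eventually_profile_add_le (E := E) hα hc'c _),
    eventually_ge_atTop n₀] with n absorb_constant hn
  exact (hp.treeHeight_le_of_vertexHeight_le hn₀ hn (monotoneOn_comp_log_natCast hn₀ profile_mono)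
    vertexHeight_le).trans absorb_constant

/-! ### Pascal-type recursions -/

lemma mul_choose_mul_pow_le_of_recursion {Ψ : ℕ → ℕ → ℝ} {m M : ℕ} {g β : ℝ}
    (hg : 0 ≤ g) (hβ0 : 0 ≤ β) (hβ1 : β ≤ 1)
    (hmono : ∀ i k, Ψ i k ≤ Ψ (i + 1) k) (h_nonneg : ∀ k, 0 ≤ Ψ 0 k) (h_init : g ≤ Ψ 0 0)
    (hrec : ∀ i < m, ∀ k < M, k ≤ i → g * β ^ M ≤ Ψ i k →
      Ψ i (k + 1) + β * Ψ i k ≤ Ψ (i + 1) (k + 1)) :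
    ∀ i ≤ m, ∀ k ≤ M, g * (i.choose k * β ^ k) ≤ Ψ i k := by
  intro i
  induction i with
  | zero =>
    intro _ k _
    cases k with
    | zero => simpa using h_init
    | succ k => simpa using h_nonneg _
  | succ i ih =>
    intro hi k hk
    cases k with
    | zero => simpa using (ih (by omega) 0 (by omega)).trans (hmono _ _)
    | succ k =>
      have ih_succ := ih (by omega) (k + 1) hk
      have ih_self := ih (by omega) k (by omega)
      rw [Nat.choose_succ_succ]
      push_cast
      rcases lt_or_ge i k with hik | hki
      · rw [Nat.choose_eq_zero_of_lt hik, Nat.cast_zero, zero_add]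
        exact ih_succ.trans (hmono _ _)
      · have one_le_choose : (1 : ℝ) ≤ i.choose k := by exact_mod_cast Nat.choose_pos hki
        have above_threshold : g * β ^ M ≤ g * (i.choose k * β ^ k) := by
          refine mul_le_mul_of_nonneg_left ?_ hg
          exact (pow_le_pow_of_le_one hβ0 hβ1 (by omega)).trans
            (le_mul_of_one_le_left (pow_nonneg hβ0 k) one_le_choose)
        calc g * ((i.choose k + i.choose (k + 1)) * β ^ (k + 1))
            = g * (i.choose (k + 1) * β ^ (k + 1)) + β * (g * (i.choose k * β ^ k)) := by ring
          _ ≤ Ψ i (k + 1) + β * Ψ i k := by gcongr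
          _ ≤ Ψ (i + 1) (k + 1) :=
            hrec i (by omega) k (by omega) hki (above_threshold.trans ih_self)

lemma log_factorial_le {M : ℕ} (hM : 1 ≤ M) :
    log M.factorial ≤ (M + 1) * log M + 1 - M := by
  induction M, hM using Nat.le_induction with
  | base => simp
  | succ M hM ih =>
    have : (0 : ℝ) < M := by exact_mod_cast hM
    have one_le_mul_log_sub : 1 ≤ (M + 1 : ℝ) * (log (M + 1) - log M) := by
      have hlog := Real.one_sub_inv_le_log_of_pos (show (0 : ℝ) < (M + 1) / M by positivity)
      rw [Real.log_div (by positivity) (by positivity), inv_div,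
        show 1 - (M : ℝ) / (M + 1) = 1 / (M + 1) by field_simp; ring,
        div_le_iff₀ (by positivity)] at hlog
      linarith
    rw [Nat.factorial_succ]
    push_cast
    rw [Real.log_mul (by positivity) (by positivity)]
    linarith

lemma exists_log_factorial_le {δ : ℝ} (hδ : 0 < δ) :
    ∃ M : ℕ, 1 ≤ M ∧ 1 ≤ δ * M ∧ log M.factorial ≤ M * log M - M + δ * M := by
  have hlim : Tendsto (fun x : ℝ => (log x + 1) / x) atTop (𝓝 0) := by
    simpa [add_div] using Real.isLittleO_log_id_atTop.tendsto_div_nhds_zero.add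
      ((tendsto_const_nhds (x := (1 : ℝ))).div_atTop tendsto_id)
  have hcast := tendsto_natCast_atTop_atTop (R := ℝ)
  obtain ⟨M, hlt, hδM, hM⟩ := ((hcast.eventually (hlim.eventually_lt_const hδ)).and
    (((hcast.const_mul_atTop hδ).eventually_ge_atTop 1).and (eventually_ge_atTop 1))).exists
  refine ⟨M, hM, hδM, (log_factorial_le hM).trans ?_⟩
  rw [div_lt_iff₀ (by exact_mod_cast hM)] at hlt
  linarith

lemma exists_block_of_le {s : ℕ → ℕ} {P : ℕ → Prop} {J n : ℕ} (hs : ∀ j, J ≤ j → 0 < s j)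
    (hJ : P J) (hstep : ∀ j, J ≤ j → P j → P (j + s j)) (hn : J ≤ n) :
    ∃ j, J ≤ j ∧ j ≤ n ∧ n < j + s j ∧ P j := by
  induction n, hn using Nat.le_induction with
  | base => exact ⟨J, le_rfl, le_rfl, Nat.lt_add_of_pos_right (hs J le_rfl), hJ⟩
  | succ n _ ih =>
    obtain ⟨j, hJj, hjn, hnj, hP⟩ := ih
    rcases Nat.lt_or_ge (n + 1) (j + s j) with hlt | hge
    · exact ⟨j, hJj, by omega, hlt, hP⟩
    · have := hs (j + s j) (by omega)
      exact ⟨j + s j, by omega, hge, by omega, hstep j hJj hP⟩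

/-- `ζ` increases by at most `o(1)` over windows of logarithmic length. -/
def SlowlyIncreasing (ζ : ℕ → ℝ) : Prop :=
  ∀ C δ : ℝ, 0 < δ → ∀ᶠ j : ℕ in atTop, ∀ i : ℕ, (i : ℝ) ≤ C * log j → ζ (j + i) ≤ ζ j + δ

namespace SlowlyIncreasing

variable {ζ ξ : ℕ → ℝ}

lemma add (hζ : SlowlyIncreasing ζ) (hξ : SlowlyIncreasing ξ) :
    SlowlyIncreasing (fun j => ζ j + ξ j) := by
  intro C δ hδ
  filter_upwards [hζ C (δ / 2) (half_pos hδ), hξ C (δ / 2) (half_pos hδ)] with j hζj hξj i hi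
  linarith [hζj i hi, hξj i hi]

lemma tendsto_neg_add_atBot (hζ : SlowlyIncreasing ζ) :
    Tendsto (fun j : ℕ => -(j : ℝ) + ζ j) atTop atBot := by
  obtain ⟨J, hJ⟩ := ((hζ 1 (1 / 2) (by norm_num)).and
    (tendsto_log_natCast.eventually_ge_atTop 1)).exists_forall_of_atTop
  have le_half : ∀ k : ℕ, ζ (J + k) ≤ ζ J + k / 2 := by
    intro k
    induction k with
    | zero => simp
    | succ k ih =>
      obtain ⟨hinc, hlog⟩ := hJ (J + k) (by omega)
      have hstep := hinc 1 (by push_cast at hlog ⊢; linarith)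
      push_cast
      rw [← add_assoc]
      linarith
  refine tendsto_atBot.2 fun B => ?_
  filter_upwards [eventually_ge_atTop J,
    tendsto_natCast_atTop_atTop.eventually_ge_atTop (2 * (ζ J - B))] with j hj hjB
  obtain ⟨k, rfl⟩ := Nat.exists_eq_add_of_le hj
  push_cast at hjB ⊢
  linarith [le_half k, (Nat.cast_nonneg J : (0 : ℝ) ≤ J)]

end SlowlyIncreasing

lemma tendsto_log_div_natCast : Tendsto (fun j : ℕ => log j / j) atTop (𝓝 0) :=
  Real.isLittleO_log_id_atTop.tendsto_div_nhds_zero.comp tendsto_natCast_atTop_atTop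

section Growth

variable {α δ : ℝ} {E : ℝ → ℝ} {M : ℕ} {b ζ : ℕ → ℝ}

lemma LogLike.slowlyIncreasing_natCast (hE : LogLike α E) :
    SlowlyIncreasing (fun j => E j) := by
  intro C δ hδ
  have hlim : Tendsto (fun j : ℕ => (|α| + 1) * C * (log j / j)) atTop (𝓝 0) := by
    simpa using tendsto_log_div_natCast.const_mul ((|α| + 1) * C)
  filter_upwards [tendsto_natCast_atTop_atTop.eventually
      (hE.eventually_abs_sub_le (C := |α| + 1) (by linarith)),
    hlim.eventually_lt_const hδ, eventually_ge_atTop 1] with j hlip hlt hj i hi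
  have : (0 : ℝ) < j := by exact_mod_cast hj
  have diff_le : E (j + i : ℕ) - E j ≤ (|α| + 1) * ((j + i : ℕ) - j) / j :=
    (le_abs_self _).trans (hlip _ (by exact_mod_cast Nat.le_add_right j i))
  have bound_le : (|α| + 1) * ((j + i : ℕ) - j) / j ≤ (|α| + 1) * C * (log j / j) := by
    rw [Nat.cast_add, add_sub_cancel_left, ← mul_div_assoc, mul_assoc]
    gcongr
  linarith

/-- Number of consecutive unit windows in which `M` further generations are produced. Starting with
mass `g` at `x`, after `m` windows the mass `M` generations higher is about
`choose m M * e^{-M E(x)} g`, and the least `m` for which this exceeds `e^{-m} g` is about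
`M (cost α E x - 1)`. -/
def blockWindows (α : ℝ) (E : ℝ → ℝ) (δ : ℝ) (M : ℕ) (x : ℝ) : ℕ :=
  ⌈M * (cost α E x - 1 + 5 * δ)⌉₊

namespace LogLike

lemma eventually_blockWindows_le (hE : LogLike α E) (hα : 0 < α) (δ : ℝ) (hM : 1 ≤ M) :
    ∀ᶠ x in atTop, M ≤ blockWindows α E δ M x ∧
      (blockWindows α E δ M x : ℝ) ≤ M * (cost α E x - 1 + 5 * δ) + 1 ∧
      (blockWindows α E δ M x : ℝ) ≤ M * (α + 1) * log x := by
  have hM1 : (1 : ℝ) ≤ M := by exact_mod_cast hM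
  filter_upwards [(hE.logLike_cost.tendsto_atTop hα).eventually_ge_atTop (2 + 5 * |δ|),
    hE.logLike_cost.eventually_div_log_lt (c := α + 1 / 2) (by linarith),
    Real.tendsto_log_atTop.eventually_ge_atTop (2 * (5 * |δ|)), eventually_gt_atTop 1]
    with x hcost hlt hlog hx
  rw [div_lt_iff₀ (Real.log_pos hx)] at hlt
  have one_le : 1 ≤ cost α E x - 1 + 5 * δ := by linarith [neg_abs_le δ]
  have le_ceil : (blockWindows α E δ M x : ℝ) ≤ M * (cost α E x - 1 + 5 * δ) + 1 :=
    (Nat.ceil_lt_add_one (by positivity)).le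
  refine ⟨?_, le_ceil, ?_⟩
  · have : (M : ℝ) ≤ blockWindows α E δ M x :=
      (le_mul_of_one_le_right (by positivity) one_le).trans (Nat.le_ceil _)
    exact_mod_cast this
  · have le_log : cost α E x + 5 * δ ≤ (α + 1) * log x := by linarith [le_abs_self δ]
    calc (blockWindows α E δ M x : ℝ) ≤ M * (cost α E x - 1 + 5 * δ) + 1 := le_ceil
      _ ≤ M * (cost α E x + 5 * δ) := by linarith
      _ ≤ M * ((α + 1) * log x) := by gcongr
      _ = M * (α + 1) * log x := by ring

lemma eventually_exp_le_choose_blockWindows (hE : LogLike α E) (hα : 0 < α) (hδ : 0 < δ)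
    (hM : 1 ≤ M) (hfac : log M.factorial ≤ M * log M - M + δ * M) :
    ∀ᶠ x in atTop, exp (M * (log (log x) + log α + 1 - 2 * δ)) ≤
      (blockWindows α E δ M x).choose M := by
  have hM0 : (0 : ℝ) < M := by exact_mod_cast hM
  have hlim : Tendsto (fun x => (cost α E x + (-2 + 5 * δ)) / (α * log x)) atTop (𝓝 1) := by
    simpa [add_div] using (hE.logLike_cost.tendsto_div_mul_log hα).add
      ((tendsto_const_nhds (x := -2 + 5 * δ)).div_atTop (tendsto_mul_log_atTop hα))
  filter_upwards [hE.eventually_blockWindows_le hα δ hM,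
    hlim.eventually_const_lt (show exp (-δ) < 1 by simpa using hδ), eventually_gt_atTop 1]
    with x ⟨hMm, _, _⟩ hlt hx
  set m := blockWindows α E δ M x
  have hlog := Real.log_pos hx
  rw [lt_div_iff₀ (by positivity)] at hlt
  have base_le : (M : ℝ) * (exp (-δ) * (α * log x)) ≤ (m + 1 - M : ℕ) := by
    have hm : (M : ℝ) * (cost α E x - 1 + 5 * δ) ≤ m := Nat.le_ceil _
    rw [Nat.cast_sub (by omega)]
    push_cast
    nlinarith
  have factorial_le : (M.factorial : ℝ) ≤ exp (M * log M - M + δ * M) :=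
    (Real.log_le_iff_le_exp (by positivity)).1 hfac
  refine le_trans ?_ (Nat.pow_le_choose (α := ℝ) M m)
  rw [le_div_iff₀ (by positivity)]
  calc exp (M * (log (log x) + log α + 1 - 2 * δ)) * M.factorial
      ≤ exp (M * (log (log x) + log α + 1 - 2 * δ)) * exp (M * log M - M + δ * M) := by gcongr
    _ = exp (log M + (-δ + (log α + log (log x)))) ^ M := by
        rw [← Real.exp_add, ← Real.exp_nat_mul]
        congr 1
        ring
    _ = (M * (exp (-δ) * (α * log x))) ^ M := by
        rw [Real.exp_add, Real.exp_add, Real.exp_add, Real.exp_log hM0, Real.exp_log hα,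
          Real.exp_log hlog]
    _ ≤ (m + 1 - M : ℕ) ^ M := by gcongr

lemma eventually_deriv_profile_le (hE : LogLike α E) (hα : 0 < α) {c c' : ℝ} (hc : c < c')
    (hc' : -1 < c') :
    ∀ᶠ x in atTop, ∀ t, x ≤ t → DifferentiableAt ℝ (profile α E c) t ∧
      deriv (profile α E c) t ≤ 1 / cost α E x + (1 + c') / (α * log x) ^ 2 := by
  have hexcess := (hE.tendsto_deriv_profile_sub hα c).eventually_lt_const
    (show 1 + c < 1 + c' by linarith)
  obtain ⟨X₀, hX₀⟩ := (hexcess.and ((hE.eventually_hasDerivAt_profile hα c).and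
    (((hE.logLike_cost.tendsto_atTop hα).eventually_gt_atTop 0).and
      (eventually_gt_atTop 1)))).exists_forall_of_atTop
  filter_upwards [eventually_ge_atTop X₀, hE.logLike_cost.eventually_monotoneOn hα]
    with x hx hmono t hxt
  obtain ⟨-, -, hcost, hx1⟩ := hX₀ x hx
  obtain ⟨hlt, hderiv, -, ht1⟩ := hX₀ t (hx.trans hxt)
  refine ⟨hderiv.differentiableAt, ?_⟩
  have hlogx := Real.log_pos hx1
  have hlogt := Real.log_pos ht1
  have log_le : log x ≤ log t := Real.log_le_log (by linarith) hxt
  have cost_le : 1 / cost α E t ≤ 1 / cost α E x :=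
    one_div_le_one_div_of_le hcost (hmono Set.self_mem_Ici hxt hxt)
  have correction_le : (1 + c') / (α * log t) ^ 2 ≤ (1 + c') / (α * log x) ^ 2 := by
    have : 0 ≤ 1 + c' := by linarith
    gcongr
  rw [← lt_div_iff₀ (by positivity)] at hlt
  linarith

lemma eventually_slope_mul_cost_sub_le_one (hE : LogLike α E) (hα : 0 < α) {p q : ℝ}
    (hpq : p < q) :
    ∀ᶠ x in atTop, (1 / cost α E x + p / (α * log x) ^ 2) * (cost α E x - q) ≤ 1 := by
  have hlim : Tendsto (fun x => -q * (α * log x / cost α E x) +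
      p * (cost α E x / (α * log x) + -q / (α * log x))) atTop (𝓝 (-q * 1 + p * (1 + 0))) :=
    ((hE.logLike_cost.tendsto_mul_log_div hα).const_mul (-q)).add
      (((hE.logLike_cost.tendsto_div_mul_log hα).add
        (tendsto_const_nhds.div_atTop (tendsto_mul_log_atTop hα))).const_mul p)
  filter_upwards [hlim.eventually_lt_const (show -q * 1 + p * (1 + 0) < 0 by linarith),
    (hE.logLike_cost.tendsto_atTop hα).eventually_gt_atTop 0, eventually_gt_atTop 1]
    with x hneg hcost hx
  have hlog := Real.log_pos hx
  have excess_eq : (1 / cost α E x + p / (α * log x) ^ 2) * (cost α E x - q) - 1 =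
      (-q * (α * log x / cost α E x) +
        p * (cost α E x / (α * log x) + -q / (α * log x))) / (α * log x) := by
    field_simp
    ring
  linarith [div_neg_of_neg_of_pos hneg (show 0 < α * log x by positivity)]

lemma eventually_sub_profile_le (hE : LogLike α E) (hα : 0 < α) (hδ : 0 < δ)
    (hδ1 : 8 * δ < 1) (hM : 1 ≤ M) (hMδ : 1 ≤ δ * M) :
    ∀ᶠ x in atTop, ∀ y, x ≤ y → y ≤ x + blockWindows α E δ M x →
      profile α E (-(8 * δ)) y - profile α E (-(8 * δ)) x ≤ M := by
  filter_upwards [hE.eventually_deriv_profile_le hα (show -(8 * δ) < -(7 * δ) by linarith)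
      (by linarith),
    hE.eventually_slope_mul_cost_sub_le_one hα (show 1 + -(7 * δ) < 1 - 6 * δ by linarith),
    hE.eventually_blockWindows_le hα δ hM, (hE.logLike_cost.tendsto_atTop hα).eventually_gt_atTop 0]
    with x hderiv hslope ⟨_, hwindows, _⟩ hcost y hxy hy
  set r := 1 / cost α E x + (1 + -(7 * δ)) / (α * log x) ^ 2
  have hr : 0 ≤ r := by
    have : 0 ≤ 1 + -(7 * δ) := by linarith
    positivity
  have length_le : y - x ≤ M * (cost α E x - (1 - 6 * δ)) := by linarith
  calc profile α E (-(8 * δ)) y - profile α E (-(8 * δ)) x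
      ≤ r * (y - x) := (convex_Ici x).image_sub_le_mul_sub_of_deriv_le
        (fun t ht => (hderiv t ht).1.continuousAt.continuousWithinAt)
        (fun t ht => (hderiv t (interior_subset ht)).1.differentiableWithinAt)
        (fun t ht => (hderiv t (interior_subset ht)).2) x Set.self_mem_Ici y hxy hxy
    _ ≤ r * (M * (cost α E x - (1 - 6 * δ))) := by gcongr
    _ = M * (r * (cost α E x - (1 - 6 * δ))) := by ring
    _ ≤ M := mul_le_of_le_one_right (Nat.cast_nonneg M) hslope

end LogLike

end Growth

section Recursion

/-- `Ψ j h` stands for the mass of height at least `h` after `j` windows. It grows in `j`, and once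
it exceeds the threshold `exp (-j + ζ j)`, it feeds the mass of height at least `h + 1` at rate
`η * b j`. -/
structure IsGrowthArray (b ζ : ℕ → ℝ) (η : ℝ) (Ψ : ℕ → ℕ → ℝ) : Prop where
  mono : ∀ j h, Ψ j h ≤ Ψ (j + 1) h
  nonneg : ∀ j h, 0 ≤ Ψ j h
  step : ∀ᶠ j : ℕ in atTop, ∀ h ≤ j, exp (-j + ζ j) ≤ Ψ j h →
    Ψ j (h + 1) + η * b j * Ψ j h ≤ Ψ (j + 1) (h + 1)

variable {α δ η : ℝ} {E : ℝ → ℝ} {M : ℕ} {b ζ ξ : ℕ → ℝ} {Ψ : ℕ → ℕ → ℝ}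

namespace LogLike

lemma eventually_exp_sub_le_mul (hE : LogLike α E)
    (hb : Tendsto (fun j : ℕ => b j * exp (E j)) atTop (𝓝 1)) (hη : exp (-δ) < η) (C : ℝ) :
    ∀ᶠ j : ℕ in atTop, ∀ i : ℕ, (i : ℝ) ≤ C * log j → exp (-E j - δ) ≤ η * b (j + i) := by
  have hη0 : 0 < η := (Real.exp_pos _).trans hη
  have hκ : 0 < (δ + log η) / 2 := by linarith [(Real.lt_log_iff_exp_lt hη0).2 hη]
  set κ := (δ + log η) / 2 with hκ_def
  obtain ⟨J, hJ⟩ := (hb.eventually_const_lt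
    (show exp (-κ) < 1 by simpa using hκ)).exists_forall_of_atTop
  filter_upwards [eventually_ge_atTop J, hE.slowlyIncreasing_natCast C κ hκ] with j hj hinc i hi
  have exp_le : exp (-κ) * exp (-E (j + i : ℕ)) ≤ b (j + i) := by
    rw [Real.exp_neg (E _), ← div_eq_mul_inv, div_le_iff₀ (Real.exp_pos _)]
    exact (hJ (j + i) (by omega)).le
  calc exp (-E j - δ) ≤ exp (log η + (-κ + -E (j + i : ℕ))) :=
        Real.exp_le_exp.2 (by linarith [hinc i hi])
    _ = η * (exp (-κ) * exp (-E (j + i : ℕ))) := by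
        rw [Real.exp_add, Real.exp_add, Real.exp_log hη0]
    _ ≤ η * b (j + i) := by gcongr

lemma eventually_threshold_le (hE : LogLike α E) (hζ : SlowlyIncreasing ζ) (δ C : ℝ) {A : ℝ}
    (hA : M * α < A) :
    ∀ᶠ j : ℕ in atTop, ∀ i : ℕ, (i : ℝ) ≤ C * log j →
      exp (-(j + i : ℕ) + ζ (j + i)) ≤ exp (-j + (ζ j + A * log j)) * exp (-E j - δ) ^ M := by
  have hlim : Tendsto (fun j : ℕ => A * log j - M * E j) atTop atTop :=
    ((logLike_mul_log A).sub (hE.const_mul M)).tendsto_atTop (by linarith)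
      |>.comp tendsto_natCast_atTop_atTop
  filter_upwards [hζ C 1 one_pos, hlim.eventually_ge_atTop (1 + M * δ)] with j hinc hlarge i hi
  rw [← Real.exp_nat_mul, ← Real.exp_add]
  refine Real.exp_le_exp.2 ?_
  push_cast
  linarith [hinc i hi, (Nat.cast_nonneg i : (0 : ℝ) ≤ i)]

lemma eventually_exp_le_mul_choose (hE : LogLike α E) (hα : 0 < α) (hδ : 0 < δ) (hM : 1 ≤ M)
    (hfac : log M.factorial ≤ M * log M - M + δ * M) (hξ : SlowlyIncreasing ξ) :
    ∀ᶠ j : ℕ in atTop,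
      exp (-(j + blockWindows α E δ M j : ℕ) + ξ (j + blockWindows α E δ M j)) ≤
        exp (-j + ξ j) * ((blockWindows α E δ M j).choose M * exp (-E j - δ) ^ M) := by
  have hcast := tendsto_natCast_atTop_atTop (R := ℝ)
  filter_upwards [hcast.eventually (hE.eventually_blockWindows_le hα δ hM),
    hcast.eventually (hE.eventually_exp_le_choose_blockWindows hα hδ hM hfac),
    hξ (M * (α + 1)) δ hδ] with j ⟨_, _, hlog⟩ hchoose hinc
  have hwindows : (M : ℝ) * (cost α E j - 1 + 5 * δ) ≤ blockWindows α E δ M j := Nat.le_ceil _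
  have hδM : δ ≤ M * δ := le_mul_of_one_le_left hδ.le (by exact_mod_cast hM)
  rw [cost] at hwindows
  calc exp (-(j + blockWindows α E δ M j : ℕ) + ξ (j + blockWindows α E δ M j))
      ≤ exp (-j + ξ j) * (exp (M * (log (log j) + log α + 1 - 2 * δ)) *
          exp (M * (-E j - δ))) := by
        rw [← Real.exp_add, ← Real.exp_add]
        refine Real.exp_le_exp.2 ?_
        push_cast
        linarith [hinc _ hlog]
    _ ≤ exp (-j + ξ j) * ((blockWindows α E δ M j).choose M * exp (-E j - δ) ^ M) := by
        rw [Real.exp_nat_mul (-E j - δ)]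
        gcongr

end LogLike

namespace IsGrowthArray

lemma eventually_block (hΨ : IsGrowthArray b ζ η Ψ) (hE : LogLike α E) (hα : 0 < α)
    (hb : Tendsto (fun j : ℕ => b j * exp (E j)) atTop (𝓝 1)) (hζ : SlowlyIncreasing ζ)
    (hδ : 0 < δ) (hη : exp (-δ) < η) (hM : 1 ≤ M)
    (hfac : log M.factorial ≤ M * log M - M + δ * M) {A : ℝ} (hA : M * α < A) :
    ∀ᶠ j : ℕ in atTop, ∀ h ≤ j, exp (-j + (ζ j + A * log j)) ≤ Ψ j h →
      exp (-(j + blockWindows α E δ M j : ℕ) + (ζ (j + blockWindows α E δ M j) +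
        A * log (j + blockWindows α E δ M j : ℕ))) ≤ Ψ (j + blockWindows α E δ M j) (h + M) := by
  have hcast := tendsto_natCast_atTop_atTop (R := ℝ)
  obtain ⟨J, hJ⟩ := hΨ.step.exists_forall_of_atTop
  filter_upwards [eventually_ge_atTop J,
    hcast.eventually (hE.eventually_blockWindows_le hα δ hM),
    hE.eventually_exp_sub_le_mul hb hη (M * (α + 1)),
    hE.eventually_threshold_le hζ δ (M * (α + 1)) hA,
    hE.eventually_exp_le_mul_choose hα hδ hM hfac
      (hζ.add (logLike_mul_log A).slowlyIncreasing_natCast),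
    hcast.eventually ((hE.tendsto_atTop hα).eventually_ge_atTop 0)]
    with j hjJ ⟨_, _, hlog⟩ hwindow hthreshold hgain hE0 h hhj hinit
  refine hgain.trans (mul_choose_mul_pow_le_of_recursion (Ψ := fun i k => Ψ (j + i) (h + k))
    (Real.exp_pos _).le (Real.exp_pos _).le (Real.exp_le_one_iff.2 (by linarith))
    (fun i k => hΨ.mono _ _) (fun k => hΨ.nonneg _ _) hinit (fun i hi k _ hki habove => ?_)
    _ le_rfl M le_rfl)
  have hile : (i : ℝ) ≤ M * (α + 1) * log j := (Nat.cast_le.2 hi.le).trans hlog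
  have hstep := hJ (j + i) (by omega) (h + k) (by omega) ((hthreshold i hile).trans habove)
  exact (add_le_add_right (mul_le_mul_of_nonneg_right (hwindow i hile) (hΨ.nonneg _ _)) _).trans
    hstep

lemma exists_profile_sub_le (hΨ : IsGrowthArray b ζ η Ψ) (hE : LogLike α E) (hα : 0 < α)
    (hb : Tendsto (fun j : ℕ => b j * exp (E j)) atTop (𝓝 1)) (hζ : SlowlyIncreasing ζ)
    (hδ : 0 < δ) (hδ1 : 8 * δ < 1) (hη : exp (-δ) < η) {w₀ : ℝ} (hw₀ : 0 < w₀)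
    (hinit : ∀ᶠ j in atTop, w₀ ≤ Ψ j 0) :
    ∃ B : ℝ, ∀ᶠ x in atTop, ∃ h : ℕ, profile α E (-(8 * δ)) x - B ≤ h ∧ 0 < Ψ ⌊x⌋₊ h := by
  obtain ⟨M, hM, hMδ, hfac⟩ := exists_log_factorial_le hδ
  set A : ℝ := M * α + 1
  set U := profile α E (-(8 * δ))
  have hsmall := (hζ.add (logLike_mul_log A).slowlyIncreasing_natCast).tendsto_neg_add_atBot
  have hcast := tendsto_natCast_atTop_atTop (R := ℝ)
  obtain ⟨J, hJ⟩ := ((hΨ.eventually_block hE hα hb hζ hδ hη hM hfac (lt_add_one _)).and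
    ((hcast.eventually (hE.eventually_sub_profile_le hα hδ hδ1 hM hMδ)).and
    ((hcast.eventually (hE.eventually_blockWindows_le hα δ hM)).and
    ((hsmall.eventually_le_atBot (log w₀)).and hinit)))).exists_forall_of_atTop
  have exists_block {n : ℕ} (hn : J ≤ n) : ∃ j, J ≤ j ∧ j ≤ n ∧ n < j + blockWindows α E δ M j ∧
      ∃ h ≤ j, exp (-j + (ζ j + A * log j)) ≤ Ψ j h ∧ U j - U J ≤ h := by
    refine exists_block_of_le (s := fun j : ℕ => blockWindows α E δ M j)
      (fun j hj => hM.trans (hJ j hj).2.2.1.1) ?_ ?_ hn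
    · obtain ⟨-, -, -, hle, hw₀J⟩ := hJ J le_rfl
      exact ⟨0, Nat.zero_le _, ((Real.le_log_iff_exp_le hw₀).1 hle).trans hw₀J, by simp⟩
    · rintro j hj ⟨h, hhj, hmass, hheight⟩
      obtain ⟨hblock, hprofile, ⟨hMj, -, -⟩, -, -⟩ := hJ j hj
      refine ⟨h + M, by omega, hblock h hhj hmass, ?_⟩
      have := hprofile (j + blockWindows α E δ M j : ℕ) (by simp) (by simp)
      push_cast at this ⊢
      linarith
  refine ⟨M + U J, ?_⟩
  filter_upwards [eventually_ge_atTop (J : ℝ)] with x hJx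
  have hx0 : 0 ≤ x := (Nat.cast_nonneg _).trans hJx
  obtain ⟨j, hJj, hjx, hxj, h, -, hmass, hheight⟩ := exists_block (Nat.le_floor hJx)
  refine ⟨h, ?_, (Real.exp_pos _).trans_le (hmass.trans ?_)⟩
  · have := (hJ j hJj).2.1 x ((Nat.le_floor_iff hx0).1 hjx)
      (by exact_mod_cast ((Nat.floor_lt hx0).1 hxj).le)
    linarith
  · exact monotone_nat_of_le_succ (f := fun j => Ψ j h) (fun j => hΨ.mono j h) hjx

lemma exists_eventually_profile_le (hE : LogLike α E) (hα : 0 < α) {c : ℝ} (hc : 0 < c) :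
    ∃ η : ℝ, 0 < η ∧ η < 1 ∧ ∀ (b ζ : ℕ → ℝ) (Ψ : ℕ → ℕ → ℝ) (w₀ : ℝ),
      Tendsto (fun j : ℕ => b j * exp (E j)) atTop (𝓝 1) → SlowlyIncreasing ζ →
      IsGrowthArray b ζ η Ψ → 0 < w₀ → (∀ᶠ j in atTop, w₀ ≤ Ψ j 0) →
      ∀ᶠ x in atTop, ∃ h : ℕ, profile α E (-c) x ≤ h ∧ 0 < Ψ ⌊x⌋₊ h := by
  obtain ⟨δ, hδ, hδ1, hδc⟩ : ∃ δ : ℝ, 0 < δ ∧ 8 * δ < 1 ∧ 8 * δ < c :=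
    ⟨min 1 c / 16, by positivity, by linarith [min_le_left 1 c], by linarith [min_le_right 1 c]⟩
  obtain ⟨η, hη, hη1⟩ := exists_between (show exp (-δ) < 1 by simpa using hδ)
  refine ⟨η, (Real.exp_pos _).trans hη, hη1, fun b ζ Ψ w₀ hb hζ hΨ hw₀ hinit => ?_⟩
  obtain ⟨B, hB⟩ := hΨ.exists_profile_sub_le hE hα hb hζ hδ hδ1 hη hw₀ hinit
  filter_upwards [hB, eventually_profile_add_le (E := E) hα (show -c < -(8 * δ) by linarith) B]
    with x ⟨h, hheight, hmass⟩ hle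
  exact ⟨h, by linarith, hmass⟩

end IsGrowthArray

end Recursion

/-! ### Averaging over the parent of a new vertex -/

lemma treeSigma_mono {Ω : Type*} (K : ℕ → Ω → ℕ) : Monotone (treeSigma K) :=
  fun _ _ h => biSup_mono fun _ hi => ⟨hi.1, hi.2.trans h⟩

lemma measurable_parent_treeSigma {Ω : Type*} (K : ℕ → Ω → ℕ) {m n : ℕ} (hm : 2 ≤ m)
    (hmn : m ≤ n) : Measurable[treeSigma K n] (K m) :=
  measurable_iff_comap_le.2 (le_biSup (fun m => MeasurableSpace.comap (K m) ⊤)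
    (show m ∈ Set.Icc 2 n from ⟨hm, hmn⟩))

lemma measurable_treeSigma_of_le {Ω : Type*} {K : ℕ → Ω → ℕ} {m n : ℕ} {f : Ω → ℝ} (hmn : m ≤ n)
    (hf : Measurable[treeSigma K m] f) : Measurable[treeSigma K n] f :=
  hf.mono (treeSigma_mono K hmn) le_rfl

section Weights

variable {w : ℕ → ℝ}

lemma totalWeight_succ (w : ℕ → ℝ) (n : ℕ) :
    totalWeight w (n + 1) = totalWeight w n + w (n + 1) :=
  Finset.sum_Icc_succ_top (by omega) _

lemma totalWeight_mono (hw : ∀ i, 1 ≤ i → 0 ≤ w i) : Monotone (totalWeight w) :=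
  monotone_nat_of_le_succ fun n => by
    rw [totalWeight_succ]
    linarith [hw (n + 1) (by omega)]

lemma totalWeight_pos (hw : ∀ i, 1 ≤ i → 0 ≤ w i) (hw1 : 0 < w 1) {n : ℕ} (hn : 1 ≤ n) :
    0 < totalWeight w n :=
  lt_of_lt_of_le (by simpa [totalWeight] using hw1) (totalWeight_mono hw hn)

/-- Mean of `y` over the labels `1, …, n`, weighted by `w`. -/
def weightedMean (w y : ℕ → ℝ) (n : ℕ) : ℝ :=
  (∑ k ∈ Finset.Icc 1 n, w k * y k) / totalWeight w n

lemma weightedMean_const_mul (w : ℕ → ℝ) (a : ℝ) (y : ℕ → ℝ) (n : ℕ) :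
    weightedMean w (fun k => a * y k) n = a * weightedMean w y n := by
  rw [weightedMean, weightedMean, ← mul_div_assoc, Finset.mul_sum]
  simp only [mul_left_comm]

lemma weightedMean_succ (hw : ∀ i, 1 ≤ i → 0 ≤ w i) (hw1 : 0 < w 1) (y : ℕ → ℝ) {n : ℕ}
    (hn : 1 ≤ n) :
    weightedMean w y (n + 1) = weightedMean w y n +
      (y (n + 1) - weightedMean w y n) * (w (n + 1) / totalWeight w (n + 1)) := by
  have hW := totalWeight_pos hw hw1 hn
  have hW' := totalWeight_pos hw hw1 (show 1 ≤ n + 1 by omega)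
  have hw_succ : w (n + 1) = totalWeight w (n + 1) - totalWeight w n := by
    linarith [totalWeight_succ w n]
  rw [weightedMean, weightedMean, Finset.sum_Icc_succ_top (by omega), hw_succ]
  field_simp
  ring

/-- Upper bound for the logarithm of the mean of `e^S` over a `w`-distributed vertex among the first
`n`, where `S` is the sum of `f` along the path from that vertex to the root. -/
def momentExponent (w f : ℕ → ℝ) (n : ℕ) : ℝ :=
  ∑ i ∈ Finset.Icc 2 n, (exp (f i) - 1) * (w i / totalWeight w i)

lemma momentExponent_succ (w f : ℕ → ℝ) {n : ℕ} (hn : 1 ≤ n) :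
    momentExponent w f (n + 1) =
      momentExponent w f n + (exp (f (n + 1)) - 1) * (w (n + 1) / totalWeight w (n + 1)) :=
  Finset.sum_Icc_succ_top (by omega) _

lemma weightedMean_le_exp_momentExponent (hw : ∀ i, 1 ≤ i → 0 ≤ w i) (hw1 : 0 < w 1) {f y : ℕ → ℝ}
    (hy1 : y 1 = 1) (hy : ∀ n, 1 ≤ n → y (n + 1) = exp (f (n + 1)) * weightedMean w y n) {n : ℕ}
    (hn : 1 ≤ n) : weightedMean w y n ≤ exp (momentExponent w f n) := by
  induction n, hn using Nat.le_induction with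
  | base => simp [weightedMean, momentExponent, totalWeight, hy1, hw1.ne']
  | succ n hn ih =>
    have hW := totalWeight_pos hw hw1 (show 1 ≤ n + 1 by omega)
    have share_nonneg : 0 ≤ w (n + 1) / totalWeight w (n + 1) :=
      div_nonneg (hw _ (by omega)) hW.le
    have share_le_one : w (n + 1) / totalWeight w (n + 1) ≤ 1 := by
      rw [div_le_one hW]
      linarith [totalWeight_succ w n, totalWeight_pos hw hw1 hn]
    rw [weightedMean_succ hw hw1 y hn, hy n hn, momentExponent_succ w f hn, Real.exp_add]
    calc weightedMean w y n + (exp (f (n + 1)) * weightedMean w y n - weightedMean w y n) *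
          (w (n + 1) / totalWeight w (n + 1))
        = weightedMean w y n *
          ((exp (f (n + 1)) - 1) * (w (n + 1) / totalWeight w (n + 1)) + 1) := by ring
      _ ≤ _ := mul_le_mul ih (Real.add_one_le_exp _)
          (by nlinarith [Real.exp_pos (f (n + 1))]) (Real.exp_pos _).le

section Integral

variable {Ω : Type*} [MeasurableSpace Ω] {μ : Measure Ω} {F : ℕ → Ω → ℝ} {n : ℕ}

lemma integrable_weightedMean (hF : ∀ k ∈ Finset.Icc 1 n, Integrable (F k) μ) :
    Integrable (fun ω => weightedMean w (fun k => F k ω) n) μ :=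
  (integrable_finsetSum _ fun k hk => (hF k hk).const_mul (w k)).div_const _

lemma integral_weightedMean (hF : ∀ k ∈ Finset.Icc 1 n, Integrable (F k) μ) :
    ∫ ω, weightedMean w (fun k => F k ω) n ∂μ = weightedMean w (fun k => ∫ ω, F k ω ∂μ) n := by
  simp only [weightedMean]
  rw [integral_div, integral_finsetSum _ fun k hk => (hF k hk).const_mul (w k)]
  simp only [integral_const_mul]

end Integral

end Weights

namespace IsWRT

variable {Ω : Type*} [MeasurableSpace Ω] {μ : Measure Ω} {w : ℕ → ℝ} {K : ℕ → Ω → ℕ} {n : ℕ}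

lemma isParentMap (hK : IsWRT μ w K) (ω : Ω) : IsParentMap (fun m => K m ω) :=
  fun n hn => hK.parent_mem n hn ω

lemma treeSigma_le (hK : IsWRT μ w K) (n : ℕ) : treeSigma K n ≤ ‹MeasurableSpace Ω› := by
  refine iSup₂_le fun m ⟨hm, _⟩ => ?_
  obtain ⟨k, rfl⟩ : ∃ k, m = k + 1 := ⟨m - 1, by omega⟩
  exact (hK.measurable_parent k (by omega)).comap_le

lemma finite_range (hK : IsWRT μ w K) {f : Ω → ℝ} (hf : Measurable[treeSigma K n] f) :
    (Set.range f).Finite := by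
  let parents : Ω → (Set.Icc 2 n → ℕ) := fun ω m => K m ω
  have treeSigma_le_comap : treeSigma K n ≤ MeasurableSpace.comap parents ⊤ := by
    refine iSup₂_le fun m hm => ?_
    rintro _ ⟨t, -, rfl⟩
    exact ⟨{v | v ⟨m, hm⟩ ∈ t}, trivial, rfl⟩
  have finite_range_parents : (Set.range parents).Finite := by
    refine (Set.Finite.pi (t := fun _ => Set.Iic n) fun _ => Set.finite_Iic n).subset ?_
    rintro _ ⟨ω, rfl⟩ ⟨m, hm⟩ -
    exact ((hK.isParentMap ω).lt hm.1).le.trans hm.2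
  let _ : MeasurableSpace (Set.Icc 2 n → ℕ) := ⊤
  obtain ⟨g, -, rfl⟩ := (hf.mono treeSigma_le_comap le_rfl).exists_eq_measurable_comp
  rw [Set.range_comp]
  exact finite_range_parents.image g

lemma comp_parent_eq_sum (hK : IsWRT μ w K) (hn : 1 ≤ n) (F : ℕ → Ω → ℝ) (ω : Ω) :
    F (K (n + 1) ω) ω =
      ∑ k ∈ Finset.Icc 1 n, F k ω * (K (n + 1) ⁻¹' {k}).indicator (fun _ => (1 : ℝ)) ω := by
  rw [Finset.sum_eq_single (K (n + 1) ω)]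
  · simp
  · intro k _ hk
    rw [Set.indicator_of_notMem (by simpa using hk.symm), mul_zero]
  · exact fun h => absurd (Finset.mem_Icc.2 (hK.parent_mem n hn ω)) h

lemma measurable_comp_parent (hK : IsWRT μ w K) (hn : 1 ≤ n) {F : ℕ → Ω → ℝ}
    (hF : ∀ k ∈ Finset.Icc 1 n, Measurable[treeSigma K n] (F k)) :
    Measurable[treeSigma K (n + 1)] (fun ω => F (K (n + 1) ω) ω) := by
  rw [funext (hK.comp_parent_eq_sum hn F)]
  refine Finset.measurable_fun_sum _ fun k hk => ?_
  refine (measurable_treeSigma_of_le (by omega) (hF k hk)).mul ?_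
  exact Measurable.indicator measurable_const
    (measurable_parent_treeSigma K (by omega) le_rfl (measurableSet_singleton k))

lemma measurable_pathSum (hK : IsWRT μ w K) (f : ℕ → ℝ) {m : ℕ} (hm : 1 ≤ m) (hmn : m ≤ n) :
    Measurable[treeSigma K n] (fun ω => pathSum f (fun i => K i ω) m) := by
  suffices Measurable[treeSigma K m] (fun ω => pathSum f (fun i => K i ω) m) from
    measurable_treeSigma_of_le hmn this
  clear hmn
  induction m using Nat.strong_induction_on with
  | _ m ih =>
    rcases hm.eq_or_lt with rfl | h
    · simp only [pathSum_one]
      exact measurable_const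
    · obtain ⟨k, rfl⟩ : ∃ k, m = k + 1 := ⟨m - 1, by omega⟩
      rw [show (fun ω => pathSum f (fun i => K i ω) (k + 1)) =
          fun ω => f (k + 1) + pathSum f (fun i => K i ω) (K (k + 1) ω) from
        funext fun ω => (hK.isParentMap ω).pathSum_eq f h]
      refine Measurable.const_add (hK.measurable_comp_parent (n := k) (by omega)
        (F := fun j ω => pathSum f (fun i => K i ω) j) fun j hj => ?_) _
      rw [Finset.mem_Icc] at hj
      exact measurable_treeSigma_of_le hj.2 (ih j (by omega) hj.1)

section FiniteMeasure

variable [IsFiniteMeasure μ]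

lemma integrable (hK : IsWRT μ w K) {f : Ω → ℝ} (hf : Measurable[treeSigma K n] f) :
    Integrable f μ := by
  obtain ⟨C, hC⟩ := (hK.finite_range hf).isBounded.exists_norm_le
  exact Integrable.of_bound (hf.mono (hK.treeSigma_le n) le_rfl).aestronglyMeasurable C
    (Eventually.of_forall fun ω => hC _ ⟨ω, rfl⟩)

lemma integral_comp_parent (hK : IsWRT μ w K) (hn : 1 ≤ n) {F : ℕ → Ω → ℝ}
    (hF : ∀ k ∈ Finset.Icc 1 n, Measurable[treeSigma K n] (F k)) :
    ∫ ω, F (K (n + 1) ω) ω ∂μ = weightedMean w (fun k => ∫ ω, F k ω ∂μ) n := by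
  have integrable_indicator (k : ℕ) :
      Integrable ((K (n + 1) ⁻¹' {k}).indicator (fun _ => (1 : ℝ))) μ :=
    (integrable_const 1).indicator (hK.measurable_parent n hn (measurableSet_singleton k))
  have integrable_mul (k) (hk : k ∈ Finset.Icc 1 n) : Integrable
      (F k * (K (n + 1) ⁻¹' {k}).indicator (fun _ => (1 : ℝ))) μ := by
    obtain ⟨C, hC⟩ := (hK.finite_range (hF k hk)).isBounded.exists_norm_le
    exact (integrable_indicator k).bdd_mul (hK.integrable (hF k hk)).aestronglyMeasurable
      (Eventually.of_forall fun ω => hC _ ⟨ω, rfl⟩)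
  rw [weightedMean, Finset.sum_div]
  refine (integral_congr_ae (Eventually.of_forall (hK.comp_parent_eq_sum hn F))).trans
    ((integral_finsetSum _ integrable_mul).trans (Finset.sum_congr rfl fun k hk => ?_))
  rw [mul_div_right_comm, ← integral_const_mul]
  refine (integral_condExp (hK.treeSigma_le n)).symm.trans (integral_congr_ae ?_)
  filter_upwards [condExp_mul_of_stronglyMeasurable_left (m := treeSigma K n)
      (hF k hk).stronglyMeasurable (integrable_mul k hk) (integrable_indicator k),
    hK.condProb_parent n hn k (Finset.mem_Icc.1 hk)] with ω hpull hprob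
  rw [hpull, Pi.mul_apply, hprob, mul_comm]

lemma integral_exp_pathSum_succ (hK : IsWRT μ w K) (f : ℕ → ℝ) (hn : 1 ≤ n) :
    ∫ ω, exp (pathSum f (fun i => K i ω) (n + 1)) ∂μ =
      exp (f (n + 1)) * weightedMean w (fun k => ∫ ω, exp (pathSum f (fun i => K i ω) k) ∂μ) n := by
  have exp_pathSum_succ (ω : Ω) : exp (pathSum f (fun i => K i ω) (n + 1)) =
      exp (f (n + 1)) * exp (pathSum f (fun i => K i ω) (K (n + 1) ω)) := by
    rw [(hK.isParentMap ω).pathSum_eq f (by omega), Real.exp_add]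
  simp only [exp_pathSum_succ, integral_const_mul]
  rw [hK.integral_comp_parent hn (F := fun k ω => exp (pathSum f (fun i => K i ω) k))]
  intro k hk
  rw [Finset.mem_Icc] at hk
  exact Real.measurable_exp.comp (hK.measurable_pathSum f hk.1 hk.2)

end FiniteMeasure

lemma integral_exp_pathSum_le [IsProbabilityMeasure μ] (hK : IsWRT μ w K)
    (hw : ∀ i, 1 ≤ i → 0 ≤ w i) (hw1 : 0 < w 1) (f : ℕ → ℝ) (hn : 1 ≤ n) :
    ∫ ω, exp (pathSum f (fun i => K i ω) (n + 1)) ∂μ ≤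
      exp (f (n + 1) + momentExponent w f n) := by
  rw [hK.integral_exp_pathSum_succ f hn, Real.exp_add]
  exact mul_le_mul_of_nonneg_left (weightedMean_le_exp_momentExponent hw hw1 (by simp)
    (fun n hn => hK.integral_exp_pathSum_succ f hn) hn) (Real.exp_pos _).le

end IsWRT

/-! ### The weight of the vertices of large height -/

/-- Total weight of the vertices of `T_n` of height at least `h`. -/
def tallWeight (w : ℕ → ℝ) (par : ℕ → ℕ) (n h : ℕ) : ℝ :=
  ∑ i ∈ Finset.Icc 1 n with h ≤ vertexHeight par i, w i

/-- The indicator that `k` is a vertex of `T_n` of height at least `h`. -/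
def tallIndicator (par : ℕ → ℕ) (n h k : ℕ) : ℝ :=
  if k ≤ n ∧ h ≤ vertexHeight par k then 1 else 0

/-- The weight of the vertices with labels in `(n, N]` attached to vertices of `T_n` of height at
least `h`, minus its conditional mean given `T_n`. -/
def deviation (w : ℕ → ℝ) (par : ℕ → ℕ) (n h N : ℕ) : ℝ :=
  ∑ i ∈ Finset.Ioc n N, w i *
    (tallIndicator par n h (par i) - tallWeight w par n h / totalWeight w (i - 1))

lemma sum_Icc_one_add_sum_Ioc (f : ℕ → ℝ) {n N : ℕ} (hnN : n ≤ N) :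
    ∑ i ∈ Finset.Icc 1 n, f i + ∑ i ∈ Finset.Ioc n N, f i = ∑ i ∈ Finset.Icc 1 N, f i :=
  Finset.sum_Ioc_consecutive f (Nat.zero_le n) hnN

section TallWeight

variable {w : ℕ → ℝ} {par : ℕ → ℕ} {n N h : ℕ}

lemma tallWeight_nonneg (hw : ∀ i, 1 ≤ i → 0 ≤ w i) (n h : ℕ) : 0 ≤ tallWeight w par n h :=
  Finset.sum_nonneg fun i hi => hw i (Finset.mem_Icc.1 (Finset.mem_filter.1 hi).1).1

lemma tallWeight_mono (hw : ∀ i, 1 ≤ i → 0 ≤ w i) (h : ℕ) (hnN : n ≤ N) :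
    tallWeight w par n h ≤ tallWeight w par N h :=
  Finset.sum_le_sum_of_subset_of_nonneg
    (Finset.filter_subset_filter _ (Finset.Icc_subset_Icc le_rfl hnN))
    fun i hi _ => hw i (Finset.mem_Icc.1 (Finset.mem_filter.1 hi).1).1

lemma tallWeight_zero (w : ℕ → ℝ) (par : ℕ → ℕ) (n : ℕ) :
    tallWeight w par n 0 = totalWeight w n := by
  simp [tallWeight, totalWeight]

lemma le_treeHeight_of_tallWeight_pos (hpos : 0 < tallWeight w par n h) :
    h ≤ treeHeight par n := by
  obtain ⟨i, hi, -⟩ := Finset.exists_ne_zero_of_sum_ne_zero hpos.ne'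
  rw [Finset.mem_filter] at hi
  exact hi.2.trans (Finset.le_sup hi.1)

lemma tallIndicator_sq (par : ℕ → ℕ) (n h k : ℕ) :
    tallIndicator par n h k ^ 2 = tallIndicator par n h k := by
  unfold tallIndicator
  split_ifs <;> simp

lemma weightedMean_tallIndicator (w : ℕ → ℝ) (par : ℕ → ℕ) (h : ℕ) (hnN : n ≤ N) :
    weightedMean w (tallIndicator par n h) N = tallWeight w par n h / totalWeight w N := by
  simp only [weightedMean, tallIndicator, mul_ite, mul_one, mul_zero, ← Finset.sum_filter,
    tallWeight]
  congr 2
  ext k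
  simp only [Finset.mem_filter, Finset.mem_Icc]
  omega

lemma IsParentMap.tallWeight_add_le (hp : IsParentMap par) (hw : ∀ i, 1 ≤ i → 0 ≤ w i)
    (hn : 1 ≤ n) (h : ℕ) (hnN : n ≤ N) :
    tallWeight w par n (h + 1) + ∑ i ∈ Finset.Ioc n N, w i * tallIndicator par n h (par i) ≤
      tallWeight w par N (h + 1) := by
  simp only [tallWeight, Finset.sum_filter]
  rw [← sum_Icc_one_add_sum_Ioc _ hnN]
  gcongr with i hi
  rw [Finset.mem_Ioc] at hi
  have hwi := hw i (by omega)
  rw [hp.vertexHeight_eq (show 2 ≤ i by omega), tallIndicator]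
  split_ifs <;> first | omega | simp [hwi]

lemma deviation_succ (w : ℕ → ℝ) (par : ℕ → ℕ) (h : ℕ) (hnN : n ≤ N) :
    deviation w par n h (N + 1) = deviation w par n h N + w (N + 1) *
      (tallIndicator par n h (par (N + 1)) - weightedMean w (tallIndicator par n h) N) := by
  rw [weightedMean_tallIndicator w par h hnN, deviation, Finset.sum_Ioc_succ_top hnN]
  rfl

lemma aSeq_sub_le_sum (hw : ∀ i, 1 ≤ i → 0 ≤ w i) (hw1 : 0 < w 1) (hn : 1 ≤ n) (hnN : n ≤ N) :
    aSeq w N - aSeq w n ≤ ∑ i ∈ Finset.Ioc n N, w i / totalWeight w (i - 1) := by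
  rw [aSeq, aSeq, ← sum_Icc_one_add_sum_Ioc _ hnN, add_sub_cancel_left]
  refine Finset.sum_le_sum fun i hi => ?_
  rw [Finset.mem_Ioc] at hi
  exact div_le_div_of_nonneg_left (hw i (by omega)) (totalWeight_pos hw hw1 (by omega))
    (totalWeight_mono hw (by omega))

lemma IsParentMap.mul_tallWeight_le_neg_deviation (hp : IsParentMap par)
    (hw : ∀ i, 1 ≤ i → 0 ≤ w i) (hw1 : 0 < w 1) (hn : 1 ≤ n) (hnN : n ≤ N) {η : ℝ}
    (hlt : tallWeight w par N (h + 1) <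
      tallWeight w par n (h + 1) + η * (aSeq w N - aSeq w n) * tallWeight w par n h) :
    (1 - η) * (aSeq w N - aSeq w n) * tallWeight w par n h ≤ -deviation w par n h N := by
  have deviation_eq : deviation w par n h N =
      ∑ i ∈ Finset.Ioc n N, w i * tallIndicator par n h (par i) -
        tallWeight w par n h * ∑ i ∈ Finset.Ioc n N, w i / totalWeight w (i - 1) := by
    rw [deviation, Finset.mul_sum, ← Finset.sum_sub_distrib]
    exact Finset.sum_congr rfl fun i _ => by ring
  have mean_le := mul_le_mul_of_nonneg_left (aSeq_sub_le_sum hw hw1 hn hnN)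
    (tallWeight_nonneg (par := par) hw n h)
  linarith [hp.tallWeight_add_le hw hn h hnN]

end TallWeight

lemma weightedMean_add_mul_sub_sq_le {w c : ℕ → ℝ} {N : ℕ} (hW : totalWeight w N ≠ 0)
    (hc : ∀ k, c k ^ 2 = c k) (D v : ℝ) :
    weightedMean w (fun k => (D + v * (c k - weightedMean w c N)) ^ 2) N ≤
      D ^ 2 + v ^ 2 * weightedMean w c N := by
  set m := weightedMean w c N with hm
  have sum_mul_eq : ∑ k ∈ Finset.Icc 1 N, w k * c k = m * totalWeight w N := by
    rw [hm, weightedMean, div_mul_cancel₀ _ hW]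
  have expand (k : ℕ) : w k * (D + v * (c k - m)) ^ 2 =
      w k * (D - v * m) ^ 2 + w k * c k * (v ^ 2 + 2 * v * (D - v * m)) := by
    linear_combination w k * v ^ 2 * hc k
  calc weightedMean w (fun k => (D + v * (c k - m)) ^ 2) N
      = (totalWeight w N * (D - v * m) ^ 2 +
          m * totalWeight w N * (v ^ 2 + 2 * v * (D - v * m))) / totalWeight w N := by
        rw [weightedMean, Finset.sum_congr rfl fun k _ => expand k, Finset.sum_add_distrib,
          ← Finset.sum_mul, ← Finset.sum_mul, sum_mul_eq]
        rfl
    _ = D ^ 2 + v ^ 2 * m - (v * m) ^ 2 := by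
        field_simp
        ring
    _ ≤ D ^ 2 + v ^ 2 * m := sub_le_self _ (sq_nonneg _)

/-- The inverse square `t⁻²`, cut off to `0` below `θ`: the weight that turns the second moment of
`deviation` into a relative Chebyshev bound. -/
def truncInvSq (θ t : ℝ) : ℝ := if θ ≤ t then (t ^ 2)⁻¹ else 0

lemma measurable_truncInvSq (θ : ℝ) : Measurable (truncInvSq θ) :=
  Measurable.ite measurableSet_Ici (measurable_id.pow_const 2).inv measurable_const

lemma truncInvSq_nonneg (θ t : ℝ) : 0 ≤ truncInvSq θ t := by
  unfold truncInvSq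
  split_ifs <;> positivity

lemma truncInvSq_mul_le {θ : ℝ} (hθ : 0 < θ) (t : ℝ) : truncInvSq θ t * t ≤ 1 / θ := by
  unfold truncInvSq
  split_ifs with hθt
  · rw [inv_mul_eq_div, pow_two, div_mul_cancel_left₀ (hθ.trans_le hθt).ne', ← one_div]
    exact one_div_le_one_div_of_le hθ hθt
  · rw [zero_mul]
    positivity

lemma sq_le_truncInvSq_mul_sq {θ t c d : ℝ} (hθ : 0 < θ) (hθt : θ ≤ t) (hc : 0 ≤ c)
    (hle : c * t ≤ d) : c ^ 2 ≤ truncInvSq θ t * d ^ 2 := by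
  have ht : 0 < t := hθ.trans_le hθt
  rw [truncInvSq, if_pos hθt, inv_mul_eq_div, le_div_iff₀ (by positivity), ← mul_pow]
  exact pow_le_pow_left₀ (by positivity) hle 2

namespace IsWRT

variable {Ω : Type*} [MeasurableSpace Ω] {μ : Measure Ω} {w : ℕ → ℝ} {K : ℕ → Ω → ℕ} {n N : ℕ}
  {X : Ω → ℝ}

lemma measurableSet_le_vertexHeight (hK : IsWRT μ w K) (h : ℕ) {m : ℕ} (hm : 1 ≤ m)
    (hmn : m ≤ n) : MeasurableSet[treeSigma K n] {ω | h ≤ vertexHeight (fun i => K i ω) m} := by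
  rw [show {ω | h ≤ vertexHeight (fun i => K i ω) m} =
      (fun ω => pathSum (fun _ => 1) (fun i => K i ω) m) ⁻¹' Set.Ici (h : ℝ) by
    ext ω
    simp [pathSum_const_one]]
  exact hK.measurable_pathSum _ hm hmn measurableSet_Ici

lemma measurable_tallWeight (hK : IsWRT μ w K) (n h : ℕ) :
    Measurable[treeSigma K n] (fun ω => tallWeight w (fun i => K i ω) n h) := by
  simp only [tallWeight, Finset.sum_filter]
  refine Finset.measurable_fun_sum _ fun i hi => ?_
  rw [Finset.mem_Icc] at hi
  exact Measurable.ite (hK.measurableSet_le_vertexHeight h hi.1 hi.2) measurable_const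
    measurable_const

lemma measurable_tallIndicator (hK : IsWRT μ w K) (n h : ℕ) {k : ℕ} (hk : 1 ≤ k) :
    Measurable[treeSigma K n] (fun ω => tallIndicator (fun i => K i ω) n h k) := by
  unfold tallIndicator
  by_cases hkn : k ≤ n
  · simp only [hkn, true_and]
    exact Measurable.ite (hK.measurableSet_le_vertexHeight h hk hkn) measurable_const
      measurable_const
  · simp only [hkn, false_and, if_false]
    exact measurable_const

lemma measurable_deviation (hK : IsWRT μ w K) (hn : 1 ≤ n) (h : ℕ) (hnN : n ≤ N) :
    Measurable[treeSigma K N] (fun ω => deviation w (fun i => K i ω) n h N) := by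
  induction N, hnN using Nat.le_induction with
  | base =>
    simp only [deviation, Finset.Ioc_self, Finset.sum_empty]
    exact measurable_const
  | succ N hnN ih =>
    simp only [deviation_succ w _ h hnN, weightedMean_tallIndicator w _ h hnN]
    refine (measurable_treeSigma_of_le (by omega) ih).add (Measurable.const_mul
      (Measurable.sub ?_ (Measurable.div_const ?_ _)) _)
    · exact hK.measurable_comp_parent (n := N) (by omega)
        (F := fun k ω => tallIndicator (fun i => K i ω) n h k) fun k hk =>
          measurable_treeSigma_of_le hnN
            (hK.measurable_tallIndicator n h (Finset.mem_Icc.1 hk).1)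
    · exact measurable_treeSigma_of_le (by omega) (hK.measurable_tallWeight n h)

section FiniteMeasure

variable [IsFiniteMeasure μ]

lemma integral_mul_deviation_sq_succ_le (hK : IsWRT μ w K) (hw : ∀ i, 1 ≤ i → 0 ≤ w i)
    (hw1 : 0 < w 1) (hn : 1 ≤ n) (h : ℕ) (hnN : n ≤ N) (hX : Measurable[treeSigma K n] X)
    (hX0 : ∀ ω, 0 ≤ X ω) :
    ∫ ω, X ω * deviation w (fun i => K i ω) n h (N + 1) ^ 2 ∂μ ≤
      ∫ ω, X ω * deviation w (fun i => K i ω) n h N ^ 2 ∂μ +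
        w (N + 1) ^ 2 / totalWeight w N * ∫ ω, X ω * tallWeight w (fun i => K i ω) n h ∂μ := by
  have hW := totalWeight_pos hw hw1 (hn.trans hnN)
  have hXN := measurable_treeSigma_of_le hnN hX
  have hdev := hK.measurable_deviation hn h hnN
  have htall := measurable_treeSigma_of_le hnN (hK.measurable_tallWeight n h)
  set F : ℕ → Ω → ℝ := fun k ω => X ω * (deviation w (fun i => K i ω) n h N + w (N + 1) *
    (tallIndicator (fun i => K i ω) n h k -
      weightedMean w (tallIndicator (fun i => K i ω) n h) N)) ^ 2 with hF
  have measurable_F (k) (hk : k ∈ Finset.Icc 1 N) : Measurable[treeSigma K N] (F k) := by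
    simp only [hF, weightedMean_tallIndicator w _ h hnN]
    exact hXN.mul ((hdev.add (((measurable_treeSigma_of_le hnN (hK.measurable_tallIndicator n h
      (Finset.mem_Icc.1 hk).1)).sub (htall.div_const _)).const_mul _)).pow_const 2)
  have weightedMean_F_le (ω : Ω) : weightedMean w (fun k => F k ω) N ≤
      X ω * deviation w (fun i => K i ω) n h N ^ 2 +
        w (N + 1) ^ 2 / totalWeight w N * (X ω * tallWeight w (fun i => K i ω) n h) := by
    have hle := weightedMean_add_mul_sub_sq_le hW.ne' (tallIndicator_sq (fun i => K i ω) n h)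
      (deviation w (fun i => K i ω) n h N) (w (N + 1))
    calc weightedMean w (fun k => F k ω) N ≤ X ω * (deviation w (fun i => K i ω) n h N ^ 2 +
          w (N + 1) ^ 2 * weightedMean w (tallIndicator (fun i => K i ω) n h) N) := by
          rw [weightedMean_const_mul]
          exact mul_le_mul_of_nonneg_left hle (hX0 ω)
      _ = _ := by
          rw [weightedMean_tallIndicator w _ h hnN]
          ring
  have integrable_dev : Integrable (fun ω => X ω * deviation w (fun i => K i ω) n h N ^ 2) μ :=
    hK.integrable (hXN.mul (hdev.pow_const 2))
  have integrable_tall : Integrable (fun ω => w (N + 1) ^ 2 / totalWeight w N *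
      (X ω * tallWeight w (fun i => K i ω) n h)) μ := (hK.integrable (hXN.mul htall)).const_mul _
  simp only [deviation_succ w _ h hnN]
  rw [← integral_const_mul, ← integral_add integrable_dev integrable_tall]
  refine (hK.integral_comp_parent (hn.trans hnN) measurable_F).trans_le ?_
  rw [← integral_weightedMean fun k hk => hK.integrable (measurable_F k hk)]
  exact integral_mono (integrable_weightedMean fun k hk => hK.integrable (measurable_F k hk))
    (integrable_dev.add integrable_tall) weightedMean_F_le

lemma integral_mul_deviation_sq_le (hK : IsWRT μ w K) (hw : ∀ i, 1 ≤ i → 0 ≤ w i)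
    (hw1 : 0 < w 1) (hn : 1 ≤ n) (h : ℕ) (hnN : n ≤ N) (hX : Measurable[treeSigma K n] X)
    (hX0 : ∀ ω, 0 ≤ X ω) :
    ∫ ω, X ω * deviation w (fun i => K i ω) n h N ^ 2 ∂μ ≤
      (∑ i ∈ Finset.Ioc n N, w i ^ 2 / totalWeight w (i - 1)) *
        ∫ ω, X ω * tallWeight w (fun i => K i ω) n h ∂μ := by
  induction N, hnN using Nat.le_induction with
  | base => simp [deviation]
  | succ N hnN ih =>
    rw [Finset.sum_Ioc_succ_top hnN, add_mul, Nat.add_sub_cancel]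
    linarith [hK.integral_mul_deviation_sq_succ_le hw hw1 hn h hnN hX hX0]

end FiniteMeasure

variable [IsProbabilityMeasure μ]

lemma measureReal_mul_tallWeight_le_neg_deviation_le (hK : IsWRT μ w K)
    (hw : ∀ i, 1 ≤ i → 0 ≤ w i) (hw1 : 0 < w 1) (hn : 1 ≤ n) (h : ℕ) (hnN : n ≤ N) {θ c : ℝ}
    (hθ : 0 < θ) (hc : 0 < c) :
    μ.real {ω | θ ≤ tallWeight w (fun i => K i ω) n h ∧
      c * tallWeight w (fun i => K i ω) n h ≤ -deviation w (fun i => K i ω) n h N} ≤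
      (∑ i ∈ Finset.Ioc n N, w i ^ 2 / totalWeight w (i - 1)) / (θ * c ^ 2) := by
  set V := ∑ i ∈ Finset.Ioc n N, w i ^ 2 / totalWeight w (i - 1)
  set Ψ : Ω → ℝ := fun ω => tallWeight w (fun i => K i ω) n h
  have hΨ : Measurable[treeSigma K n] Ψ := hK.measurable_tallWeight n h
  set X : Ω → ℝ := fun ω => truncInvSq θ (Ψ ω)
  have hX : Measurable[treeSigma K n] X := (measurable_truncInvSq θ).comp hΨ
  have hX0 (ω : Ω) : 0 ≤ X ω := truncInvSq_nonneg θ (Ψ ω)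
  have hV : 0 ≤ V := Finset.sum_nonneg fun i hi => div_nonneg (sq_nonneg _)
    (totalWeight_pos hw hw1 (by have := Finset.mem_Ioc.1 hi; omega)).le
  have integral_le : ∫ ω, X ω * Ψ ω ∂μ ≤ 1 / θ := by
    simpa using integral_mono (hK.integrable (hX.mul hΨ)) (integrable_const (1 / θ))
      fun ω => truncInvSq_mul_le hθ (Ψ ω)
  have markov := mul_meas_ge_le_integral_of_nonneg
    (Eventually.of_forall fun ω => mul_nonneg (hX0 ω) (sq_nonneg _))
    (hK.integrable ((measurable_treeSigma_of_le hnN hX).mul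
      ((hK.measurable_deviation hn h hnN).pow_const 2))) (c ^ 2)
  rw [le_div_iff₀ (by positivity)]
  calc μ.real {ω | θ ≤ Ψ ω ∧ c * Ψ ω ≤ -deviation w (fun i => K i ω) n h N} * (θ * c ^ 2)
      ≤ μ.real {ω | c ^ 2 ≤ X ω * deviation w (fun i => K i ω) n h N ^ 2} * (θ * c ^ 2) := by
        refine mul_le_mul_of_nonneg_right ?_ (by positivity)
        refine measureReal_mono (fun ω hω => ?_) (measure_ne_top μ _)
        have hle := sq_le_truncInvSq_mul_sq hθ hω.1 hc.le hω.2
        rwa [neg_sq] at hle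
    _ = θ * (c ^ 2 * μ.real {ω | c ^ 2 ≤ X ω * deviation w (fun i => K i ω) n h N ^ 2}) := by ring
    _ ≤ θ * (V * (1 / θ)) := by
        refine mul_le_mul_of_nonneg_left ?_ hθ.le
        exact markov.trans ((hK.integral_mul_deviation_sq_le hw hw1 hn h hnN hX hX0).trans
          (mul_le_mul_of_nonneg_left integral_le hV))
    _ = V := by field_simp

lemma measureReal_tallWeight_lt_le (hK : IsWRT μ w K) (hw : ∀ i, 1 ≤ i → 0 ≤ w i)
    (hw1 : 0 < w 1) (hn : 1 ≤ n) (h : ℕ) (hnN : n ≤ N) {θ η : ℝ} (hθ : 0 < θ) (hη : η < 1)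
    (hb : 0 < aSeq w N - aSeq w n) :
    μ.real {ω | θ ≤ tallWeight w (fun i => K i ω) n h ∧
      tallWeight w (fun i => K i ω) N (h + 1) < tallWeight w (fun i => K i ω) n (h + 1) +
        η * (aSeq w N - aSeq w n) * tallWeight w (fun i => K i ω) n h} ≤
      (∑ i ∈ Finset.Ioc n N, w i ^ 2 / totalWeight w (i - 1)) /
        (θ * ((1 - η) * (aSeq w N - aSeq w n)) ^ 2) :=
  (hK.measureReal_mul_tallWeight_le_neg_deviation_le hw hw1 hn h hnN hθ
    (mul_pos (sub_pos.2 hη) hb)).trans' (measureReal_mono (fun ω hω => ⟨hω.1,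
      (hK.isParentMap ω).mul_tallWeight_le_neg_deviation hw hw1 hn hnN hω.2⟩)
    (measure_ne_top μ _))

end IsWRT

/-! ### Exponential windows of labels -/

/-- The least integer that is at least `e^j`. -/
def expLabel (j : ℕ) : ℕ := ⌈exp j⌉₊

section ExpLabel

lemma exp_le_expLabel (j : ℕ) : exp j ≤ expLabel j := Nat.le_ceil _

lemma one_le_expLabel (j : ℕ) : 1 ≤ expLabel j := Nat.one_le_ceil_iff.2 (Real.exp_pos _)

lemma expLabel_mono : Monotone expLabel := fun i j hij =>
  Nat.ceil_le_ceil (Real.exp_le_exp.2 (by exact_mod_cast hij))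

lemma le_log_expLabel (j : ℕ) : (j : ℝ) ≤ log (expLabel j) := by
  rw [Real.le_log_iff_exp_le (by exact_mod_cast one_le_expLabel j)]
  exact exp_le_expLabel j

lemma log_expLabel_le (j : ℕ) : log (expLabel j) ≤ j + exp (-j) := by
  rw [Real.log_le_iff_le_exp (by exact_mod_cast one_le_expLabel j)]
  calc (expLabel j : ℝ) ≤ exp j + 1 := (Nat.ceil_lt_add_one (Real.exp_pos _).le).le
    _ = exp j * (exp (-j) + 1) := by rw [mul_add_one, ← Real.exp_add, add_neg_cancel, Real.exp_zero,
        add_comm]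
    _ ≤ exp j * exp (exp (-j)) := by
        gcongr
        exact Real.add_one_le_exp _
    _ = exp (j + exp (-j)) := (Real.exp_add _ _).symm

lemma log_expLabel_le_add_one (j : ℕ) : log (expLabel j) ≤ j + 1 :=
  (log_expLabel_le j).trans (add_le_add_right (Real.exp_le_one_iff.2 (by simp)) _)

lemma tendsto_log_expLabel_sub : Tendsto (fun j : ℕ => log (expLabel j) - j) atTop (𝓝 0) :=
  squeeze_zero (fun j => sub_nonneg.2 (le_log_expLabel j))
    (fun j => sub_le_iff_le_add'.2 (log_expLabel_le j))
    (Real.tendsto_exp_neg_atTop_nhds_zero.comp tendsto_natCast_atTop_atTop)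

lemma tendsto_log_expLabel_succ_sub :
    Tendsto (fun j : ℕ => log (expLabel (j + 1)) - log (expLabel j)) atTop (𝓝 1) := by
  have hlim := (((tendsto_add_atTop_iff_nat 1).2 tendsto_log_expLabel_sub).sub
    tendsto_log_expLabel_sub).add_const 1
  rw [sub_zero, zero_add] at hlim
  refine hlim.congr fun j => ?_
  push_cast
  ring

lemma tendsto_expLabel : Tendsto expLabel atTop atTop := by
  refine tendsto_atTop_mono (fun j => ?_) tendsto_id
  have hle : (j : ℝ) ≤ expLabel j := by linarith [exp_le_expLabel j, Real.add_one_le_exp (j : ℝ)]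
  exact_mod_cast hle

lemma expLabel_floor_log_le {n : ℕ} (hn : 1 ≤ n) : expLabel ⌊log n⌋₊ ≤ n := by
  refine Nat.ceil_le.2 ?_
  rw [← Real.le_log_iff_exp_le (by exact_mod_cast hn)]
  exact Nat.floor_le (Real.log_natCast_nonneg n)

lemma le_expLabel_floor_log {n : ℕ} (hn : 1 ≤ n) : n ≤ expLabel (⌊log n⌋₊ + 1) := by
  have hle := (Real.log_le_iff_le_exp (by exact_mod_cast hn)).1 (Nat.lt_floor_add_one (log n)).le
  have hexp := exp_le_expLabel (⌊log n⌋₊ + 1)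
  push_cast at hexp
  exact_mod_cast hle.trans hexp

end ExpLabel

/-- Increment of `a_n` over the window `(e^j, e^{j+1}]`. -/
def windowMass (w : ℕ → ℝ) (j : ℕ) : ℝ := aSeq w (expLabel (j + 1)) - aSeq w (expLabel j)

section WindowMass

variable {α : ℝ} {E : ℝ → ℝ} {w : ℕ → ℝ}

lemma LogLike.tendsto_sub_natCast (hE : LogLike α E) {x : ℕ → ℝ} (hx : ∀ᶠ j : ℕ in atTop, j ≤ x j)
    (hx' : ∀ᶠ j : ℕ in atTop, x j ≤ j + 2) : Tendsto (fun j : ℕ => E (x j) - E j) atTop (𝓝 0) := by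
  have hlim : Tendsto (fun j : ℕ => (|α| + 1) * 2 / (j : ℝ)) atTop (𝓝 0) :=
    tendsto_const_nhds.div_atTop tendsto_natCast_atTop_atTop
  refine squeeze_zero_norm' ?_ hlim
  filter_upwards [tendsto_natCast_atTop_atTop.eventually
    (hE.eventually_abs_sub_le (C := |α| + 1) (by linarith)), hx, hx'] with j hlip hxj hxj'
  refine (hlip _ hxj).trans ?_
  gcongr
  linarith

lemma LogLike.tendsto_exp_neg_mul_exp (hE : LogLike α E) {x : ℕ → ℝ}
    (hx : ∀ᶠ j : ℕ in atTop, j ≤ x j) (hx' : ∀ᶠ j : ℕ in atTop, x j ≤ j + 2) :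
    Tendsto (fun j : ℕ => exp (-E (x j)) * exp (E j)) atTop (𝓝 1) := by
  have hlim := (Real.continuous_exp.tendsto _).comp (hE.tendsto_sub_natCast hx hx').neg
  rw [neg_zero, Real.exp_zero] at hlim
  refine hlim.congr fun j => ?_
  rw [Function.comp_apply, ← Real.exp_add]
  congr 1
  ring

lemma LogLike.tendsto_integral_window (hE : LogLike α E) (hcont : ContinuousOn E (Set.Ici 1)) :
    Tendsto (fun j : ℕ => (∫ t in log (expLabel j)..log (expLabel (j + 1)), exp (-E t)) *
      exp (E j)) atTop (𝓝 1) := by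
  set x : ℕ → ℝ := fun j => log (expLabel j)
  have x_lt : ∀ᶠ j in atTop, x j < x (j + 1) :=
    (tendsto_log_expLabel_succ_sub.eventually_const_lt one_pos).mono fun j hj => sub_pos.1 hj
  have exists_mean : ∀ᶠ j : ℕ in atTop, ∃ c ∈ Set.Ioo (x j) (x (j + 1)),
      ∫ t in x j..x (j + 1), exp (-E t) = exp (-E c) * (x (j + 1) - x j) := by
    filter_upwards [x_lt, eventually_ge_atTop 1] with j hlt hj
    have subset : Set.uIcc (x j) (x (j + 1)) ⊆ Set.Ici 1 := by
      rw [Set.uIcc_of_le hlt.le]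
      exact fun t ht => (show (1 : ℝ) ≤ j by exact_mod_cast hj).trans
        ((le_log_expLabel j).trans ht.1)
    obtain ⟨c, hc, hmean⟩ := exists_eq_interval_average hlt.ne
      (Real.continuous_exp.comp_continuousOn (hcont.mono subset).neg)
    rw [Set.uIoo_of_lt hlt] at hc
    refine ⟨c, hc, ?_⟩
    rw [Function.comp_apply, interval_average_eq_div] at hmean
    rw [eq_div_iff (sub_pos.2 hlt).ne'] at hmean
    exact hmean.symm
  obtain ⟨c, hc⟩ := exists_mean.choice
  have hlim := (hE.tendsto_exp_neg_mul_exp (x := c)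
    (hc.mono fun j hj => (le_log_expLabel j).trans hj.1.1.le)
    (hc.mono fun j hj => hj.1.2.le.trans ((log_expLabel_le_add_one (j + 1)).trans
      (by push_cast; linarith)))).mul tendsto_log_expLabel_succ_sub
  rw [one_mul] at hlim
  refine hlim.congr' ?_
  filter_upwards [hc] with j hj
  rw [hj.2]
  ring

lemma LogLike.tendsto_mul_exp_expLabel (hE : LogLike α E) {err : ℕ → ℝ}
    (herr : err =o[atTop] fun n : ℕ => exp (-E (log n))) {k : ℕ} (hk : k ≤ 1) :
    Tendsto (fun j : ℕ => err (expLabel (j + k)) * exp (E j)) atTop (𝓝 0) := by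
  have hk' : (k : ℝ) ≤ 1 := by exact_mod_cast hk
  have herr_comp := herr.tendsto_div_nhds_zero.comp
    (tendsto_expLabel.comp (tendsto_add_atTop_nat k))
  have hlim := herr_comp.mul (hE.tendsto_exp_neg_mul_exp (x := fun j => log (expLabel (j + k)))
    (Eventually.of_forall fun j => le_trans (by push_cast; simp) (le_log_expLabel (j + k)))
    (Eventually.of_forall fun j => (log_expLabel_le_add_one (j + k)).trans
      (by push_cast; linarith)))
  rw [zero_mul] at hlim
  refine hlim.congr fun j => ?_
  simp only [Function.comp_apply]
  field_simp

lemma LogLike.tendsto_windowMass_mul_exp (hE : LogLike α E) (hcont : ContinuousOn E (Set.Ici 1))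
    (ha : (fun n : ℕ => aSeq w n - ∫ x in (1 : ℝ)..log n, exp (-E x))
      =o[atTop] fun n : ℕ => exp (-E (log n))) :
    Tendsto (fun j : ℕ => windowMass w j * exp (E j)) atTop (𝓝 1) := by
  have hlim := (hE.tendsto_integral_window hcont).add
    ((hE.tendsto_mul_exp_expLabel ha le_rfl).sub (hE.tendsto_mul_exp_expLabel ha zero_le_one))
  rw [sub_zero, add_zero] at hlim
  refine hlim.congr' ?_
  filter_upwards [eventually_ge_atTop 1] with j hj
  have hintegrable (i : ℕ) (hi : 1 ≤ i) :
      IntervalIntegrable (fun t => exp (-E t)) volume 1 (log (expLabel i)) := by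
    have one_le_log : 1 ≤ log (expLabel i) :=
      (show (1 : ℝ) ≤ i by exact_mod_cast hi).trans (le_log_expLabel i)
    refine ContinuousOn.intervalIntegrable (Real.continuous_exp.comp_continuousOn
      (hcont.mono ?_).neg)
    rw [Set.uIcc_of_le one_le_log]
    exact fun t ht => ht.1
  rw [← intervalIntegral.integral_interval_sub_left (hintegrable (j + 1) (by omega))
    (hintegrable j hj), windowMass, add_zero]
  ring

end WindowMass

section Weights

variable {w : ℕ → ℝ}

lemma aSeq_succ (w : ℕ → ℝ) (n : ℕ) :
    aSeq w (n + 1) = aSeq w n + w (n + 1) / totalWeight w (n + 1) :=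
  Finset.sum_Icc_succ_top (by omega) _

lemma eventually_totalWeight_succ_le (hw : ∀ i, 1 ≤ i → 0 ≤ w i) (hw1 : 0 < w 1)
    (hsum : Summable fun i : ℕ => w (i + 1) ^ 2 / totalWeight w (i + 1) ^ 2) :
    ∀ᶠ n : ℕ in atTop, totalWeight w (n + 1) ≤ 2 * totalWeight w n := by
  filter_upwards [hsum.tendsto_atTop_zero.eventually_lt_const
    (show (0 : ℝ) < (1 / 2) ^ 2 by norm_num)] with n hn
  rw [← div_pow] at hn
  have hlt := lt_of_pow_lt_pow_left₀ 2 (by norm_num) hn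
  rw [div_lt_iff₀ (totalWeight_pos hw hw1 (Nat.le_add_left 1 n))] at hlt
  linarith [totalWeight_succ w n]

lemma log_totalWeight_sub_le (hw : ∀ i, 1 ≤ i → 0 ≤ w i) (hw1 : 0 < w 1) {n N : ℕ} (hn : 1 ≤ n)
    (hdouble : ∀ m, n ≤ m → totalWeight w (m + 1) ≤ 2 * totalWeight w m) (hnN : n ≤ N) :
    log (totalWeight w N) - log (totalWeight w n) ≤ 2 * (aSeq w N - aSeq w n) := by
  induction N, hnN using Nat.le_induction with
  | base => simp
  | succ N hnN ih =>
    have hW := totalWeight_pos hw hw1 (hn.trans hnN)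
    have hW' := totalWeight_pos hw hw1 (show 1 ≤ N + 1 by omega)
    have log_step : log (totalWeight w (N + 1)) - log (totalWeight w N) ≤
        2 * (w (N + 1) / totalWeight w (N + 1)) :=
      calc log (totalWeight w (N + 1)) - log (totalWeight w N)
          = log (totalWeight w (N + 1) / totalWeight w N) := (Real.log_div hW'.ne' hW.ne').symm
        _ ≤ totalWeight w (N + 1) / totalWeight w N - 1 :=
            Real.log_le_sub_one_of_pos (div_pos hW' hW)
        _ = w (N + 1) / totalWeight w N := by
            rw [totalWeight_succ, add_div, div_self hW.ne', add_sub_cancel_left]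
        _ ≤ 2 * (w (N + 1) / totalWeight w (N + 1)) := by
            rw [← mul_div_assoc, div_le_div_iff₀ hW hW', mul_comm 2, mul_assoc]
            exact mul_le_mul_of_nonneg_left (hdouble N hnN) (hw _ (by omega))
    rw [aSeq_succ]
    linarith

lemma sum_Ioc_le_tsum_add {f : ℕ → ℝ} (hf0 : ∀ i, 0 ≤ f i) {n : ℕ}
    (hf : Summable fun i => f (n + i)) (N : ℕ) :
    ∑ i ∈ Finset.Ioc n N, f i ≤ ∑' i, f (n + i) :=
  calc ∑ i ∈ Finset.Ioc n N, f i ≤ ∑ i ∈ Finset.Ico n (N + 1), f i :=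
        Finset.sum_le_sum_of_subset_of_nonneg
          (fun i hi => by rw [Finset.mem_Ioc] at hi; rw [Finset.mem_Ico]; omega)
          fun i _ _ => hf0 i
    _ = ∑ i ∈ Finset.range (N + 1 - n), f (n + i) := Finset.sum_Ico_eq_sum_range _ _ _
    _ ≤ ∑' i, f (n + i) := hf.sum_le_tsum _ fun i _ => hf0 _

lemma sum_sq_div_totalWeight_le (hw : ∀ i, 1 ≤ i → 0 ≤ w i) (hw1 : 0 < w 1)
    (hsum : Summable fun i : ℕ => w (i + 1) ^ 2 / totalWeight w (i + 1) ^ 2) {n : ℕ}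
    (hn : 1 ≤ n) (hdouble : ∀ m, n ≤ m → totalWeight w (m + 1) ≤ 2 * totalWeight w m) (N : ℕ) :
    ∑ i ∈ Finset.Ioc n N, w i ^ 2 / totalWeight w (i - 1) ≤
      2 * totalWeight w N * ∑' i : ℕ, w (n + i) ^ 2 / totalWeight w (n + i) ^ 2 := by
  have summable_tail : Summable fun i : ℕ => w (n + i) ^ 2 / totalWeight w (n + i) ^ 2 :=
    ((summable_nat_add_iff (n - 1)).2 hsum).congr fun i => by
      rw [show i + (n - 1) + 1 = n + i by omega]
  have hWN : 0 ≤ totalWeight w N := Finset.sum_nonneg fun i hi => hw i (Finset.mem_Icc.1 hi).1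
  refine le_trans ?_ (mul_le_mul_of_nonneg_left (sum_Ioc_le_tsum_add
    (f := fun i => w i ^ 2 / totalWeight w i ^ 2) (fun i => by positivity) summable_tail N)
    (by positivity))
  rw [Finset.mul_sum]
  refine Finset.sum_le_sum fun i hi => ?_
  rw [Finset.mem_Ioc] at hi
  obtain ⟨k, rfl⟩ : ∃ k, i = k + 1 := ⟨i - 1, by omega⟩
  have hW := totalWeight_pos hw hw1 (show 1 ≤ k by omega)
  have hW' := totalWeight_pos hw hw1 (show 1 ≤ k + 1 by omega)
  have sq_le : totalWeight w (k + 1) ^ 2 ≤ 2 * totalWeight w N * totalWeight w k :=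
    calc totalWeight w (k + 1) ^ 2 ≤ totalWeight w N * (2 * totalWeight w k) := by
          rw [sq]
          exact mul_le_mul (totalWeight_mono hw hi.2) (hdouble k (by omega)) hW'.le hWN
      _ = 2 * totalWeight w N * totalWeight w k := by ring
  rw [Nat.add_sub_cancel, ← mul_div_assoc, div_le_div_iff₀ hW (by positivity)]
  linarith [mul_le_mul_of_nonneg_left sq_le (sq_nonneg (w (k + 1)))]

end Weights

/-! ### The lower bound -/

section BorelCantelli

variable {Ω : Type*} [MeasurableSpace Ω] {μ : Measure Ω} [IsFiniteMeasure μ]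

lemma ae_eventually_notMem_of_summable {s : ℕ → Set Ω} {f : ℕ → ℝ} (hf : Summable f)
    (hle : ∀ᶠ i in atTop, μ.real (s i) ≤ f i) : ∀ᵐ ω ∂μ, ∀ᶠ i in atTop, ω ∉ s i := by
  have hsummable : Summable fun i => μ.real (s i) := by
    refine Summable.of_norm_bounded_eventually_nat hf ?_
    filter_upwards [hle] with i hi
    rwa [Real.norm_of_nonneg measureReal_nonneg]
  refine ae_eventually_notMem ?_
  simpa [ofReal_measureReal] using hsummable.tsum_ofReal_ne_top

lemma ae_eventually_forall_le_notMem {s : ℕ → ℕ → Set Ω} {C : ℝ}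
    (hle : ∀ᶠ j : ℕ in atTop, ∀ h, μ.real (s j h) ≤ C / (j : ℝ) ^ 3) :
    ∀ᵐ ω ∂μ, ∀ᶠ j in atTop, ∀ h ≤ j, ω ∉ s j h := by
  have union_le : ∀ᶠ j : ℕ in atTop, μ.real (⋃ h ∈ Finset.range (j + 1), s j h) ≤
      2 * C * ((j : ℝ) ^ 2)⁻¹ := by
    filter_upwards [hle, eventually_ge_atTop 1] with j hj hj1
    have one_le : (1 : ℝ) ≤ j := by exact_mod_cast hj1
    have hC : 0 ≤ C / (j : ℝ) ^ 3 := measureReal_nonneg.trans (hj 0)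
    calc μ.real (⋃ h ∈ Finset.range (j + 1), s j h)
        ≤ ∑ h ∈ Finset.range (j + 1), μ.real (s j h) := measureReal_biUnion_finset_le _ _
      _ ≤ (j + 1) * (C / (j : ℝ) ^ 3) := by
          refine (Finset.sum_le_card_nsmul _ _ _ fun h _ => hj h).trans_eq ?_
          simp
      _ ≤ (2 * j) * (C / (j : ℝ) ^ 3) := by
          gcongr
          linarith
      _ = 2 * C * ((j : ℝ) ^ 2)⁻¹ := by field_simp
  have hsummable := (Real.summable_nat_pow_inv.2 one_lt_two).mul_left (2 * C)
  filter_upwards [ae_eventually_notMem_of_summable hsummable union_le] with ω hω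
  filter_upwards [hω] with j hj h hh hmem
  exact hj (Set.mem_biUnion (Finset.mem_coe.2 (Finset.mem_range.2 (Nat.lt_succ_of_le hh))) hmem)

end BorelCantelli

/-- Logarithm of the weight that the vertices of height at least `h` must have at time `e^j`,
relative to `e^{-j}`, for the growth of the next level over the window `(e^j, e^{j+1}]` to
concentrate. -/
def logThreshold (α : ℝ) (w : ℕ → ℝ) (j : ℕ) : ℝ :=
  log (totalWeight w (expLabel (j + 1))) + (2 * α + 5) * log j

section LowerBound

variable {α : ℝ} {E : ℝ → ℝ} {w : ℕ → ℝ}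

lemma LogLike.tendsto_log_mul_exp_neg (hE : LogLike α E) (hα : 0 < α) :
    Tendsto (fun x => log x * exp (-E x)) atTop (𝓝 0) := by
  have mul_exp : Tendsto (fun y : ℝ => y * exp (-(α / 2) * y)) atTop (𝓝 0) := by
    simpa using tendsto_rpow_mul_exp_neg_mul_atTop_nhds_zero 1 (α / 2) (by positivity)
  refine squeeze_zero' ?_ ?_ (mul_exp.comp Real.tendsto_log_atTop)
  · filter_upwards [eventually_gt_atTop 1] with x hx
    have := Real.log_pos hx
    positivity
  · filter_upwards [eventually_gt_atTop 1,
      hE.tendsto_div_log.eventually_const_lt (show α / 2 < α by linarith)] with x hx hlt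
    have hlog := Real.log_pos hx
    rw [lt_div_iff₀ hlog] at hlt
    rw [Function.comp_apply]
    gcongr
    linarith

lemma LogLike.eventually_windowMass_le (hE : LogLike α E) (hα : 0 < α)
    (hb : Tendsto (fun j : ℕ => windowMass w j * exp (E j)) atTop (𝓝 1)) :
    ∀ᶠ j : ℕ in atTop, ∀ l, j ≤ l → windowMass w l ≤ 2 * exp (-E j) := by
  obtain ⟨J, hJ⟩ := (hb.eventually_lt_const one_lt_two).exists_forall_of_atTop
  filter_upwards [eventually_ge_atTop J,
    tendsto_natCast_atTop_atTop.eventually (hE.eventually_monotoneOn hα)] with j hj hmono l hjl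
  have hjl' : (j : ℝ) ≤ l := by exact_mod_cast hjl
  calc windowMass w l = windowMass w l * exp (E l) * exp (-E l) := by
        rw [mul_assoc, ← Real.exp_add, add_neg_cancel, Real.exp_zero, mul_one]
    _ ≤ 2 * exp (-E j) := mul_le_mul (hJ l (hj.trans hjl)).le
        (Real.exp_le_exp.2 (neg_le_neg (hmono Set.self_mem_Ici hjl' hjl'))) (Real.exp_pos _).le
        two_pos.le

lemma aSeq_expLabel_sub_le {j : ℕ} {B : ℝ} (hB : ∀ l, j ≤ l → windowMass w l ≤ B) (i : ℕ) :
    aSeq w (expLabel (j + i)) - aSeq w (expLabel j) ≤ i * B := by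
  induction i with
  | zero => simp
  | succ i ih =>
    have hlast := hB (j + i) (Nat.le_add_right j i)
    rw [windowMass] at hlast
    push_cast
    rw [← Nat.add_assoc]
    linarith

lemma LogLike.slowlyIncreasing_log_totalWeight (hE : LogLike α E) (hα : 0 < α)
    (hw : ∀ i, 1 ≤ i → 0 ≤ w i) (hw1 : 0 < w 1)
    (hsum : Summable fun i : ℕ => w (i + 1) ^ 2 / totalWeight w (i + 1) ^ 2)
    (hb : Tendsto (fun j : ℕ => windowMass w j * exp (E j)) atTop (𝓝 1)) :
    SlowlyIncreasing fun j => log (totalWeight w (expLabel (j + 1))) := by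
  intro C δ hδ
  obtain ⟨n₁, hn₁⟩ := (eventually_totalWeight_succ_le hw hw1 hsum).exists_forall_of_atTop
  have increment_small : Tendsto (fun j : ℕ => 4 * C * (log j * exp (-E j))) atTop (𝓝 0) := by
    simpa using ((hE.tendsto_log_mul_exp_neg hα).comp tendsto_natCast_atTop_atTop).const_mul (4 * C)
  filter_upwards [increment_small.eventually_lt_const hδ, hE.eventually_windowMass_le hα hb,
    tendsto_expLabel.eventually_ge_atTop n₁] with j hsmall hmass hj i hi
  have aSeq_le := aSeq_expLabel_sub_le (fun l hl => hmass l (j.le_succ.trans hl)) i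
  have log_le := log_totalWeight_sub_le hw hw1 (one_le_expLabel (j + 1))
    (fun m hm => hn₁ m ((hj.trans (expLabel_mono j.le_succ)).trans hm))
    (expLabel_mono (Nat.le_add_right (j + 1) i))
  have mul_le := mul_le_mul_of_nonneg_right hi (show 0 ≤ 2 * exp (-E j) by positivity)
  rw [show j + i + 1 = j + 1 + i by ring]
  linarith

lemma LogLike.slowlyIncreasing_logThreshold (hE : LogLike α E) (hα : 0 < α)
    (hw : ∀ i, 1 ≤ i → 0 ≤ w i) (hw1 : 0 < w 1)
    (hsum : Summable fun i : ℕ => w (i + 1) ^ 2 / totalWeight w (i + 1) ^ 2)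
    (hb : Tendsto (fun j : ℕ => windowMass w j * exp (E j)) atTop (𝓝 1)) :
    SlowlyIncreasing (logThreshold α w) :=
  (hE.slowlyIncreasing_log_totalWeight hα hw hw1 hsum hb).add
    (logLike_mul_log (2 * α + 5)).slowlyIncreasing_natCast

lemma exists_eventually_sum_sq_window_le (hw : ∀ i, 1 ≤ i → 0 ≤ w i) (hw1 : 0 < w 1)
    (hsum : Summable fun i : ℕ => w (i + 1) ^ 2 / totalWeight w (i + 1) ^ 2)
    (hsq : (fun n : ℕ => ∑' i : ℕ, w (n + i) ^ 2 / totalWeight w (n + i) ^ 2)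
      =O[atTop] fun n : ℕ => 1 / (n : ℝ)) :
    ∃ C > 0, ∀ᶠ j : ℕ in atTop,
      ∑ i ∈ Finset.Ioc (expLabel j) (expLabel (j + 1)), w i ^ 2 / totalWeight w (i - 1) ≤
        C * (totalWeight w (expLabel (j + 1)) * exp (-j)) := by
  obtain ⟨C, hC, hbound⟩ := hsq.exists_pos
  obtain ⟨n₁, hn₁⟩ := (eventually_totalWeight_succ_le hw hw1 hsum).exists_forall_of_atTop
  refine ⟨2 * C, by positivity, ?_⟩
  filter_upwards [tendsto_expLabel.eventually hbound.bound,
    tendsto_expLabel.eventually_ge_atTop n₁] with j htail hj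
  have hW := totalWeight_pos hw hw1 (one_le_expLabel (j + 1))
  have tail_le : ∑' i : ℕ, w (expLabel j + i) ^ 2 / totalWeight w (expLabel j + i) ^ 2 ≤
      C * exp (-j) := by
    refine (le_abs_self _).trans (htail.trans ?_)
    rw [Real.norm_of_nonneg (by positivity), Real.exp_neg, one_div]
    have := inv_anti₀ (Real.exp_pos _) (exp_le_expLabel j)
    gcongr
  calc ∑ i ∈ Finset.Ioc (expLabel j) (expLabel (j + 1)), w i ^ 2 / totalWeight w (i - 1)
      ≤ 2 * totalWeight w (expLabel (j + 1)) *
          ∑' i : ℕ, w (expLabel j + i) ^ 2 / totalWeight w (expLabel j + i) ^ 2 :=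
        sum_sq_div_totalWeight_le hw hw1 hsum (one_le_expLabel j)
          (fun m hm => hn₁ m (hj.trans hm)) _
    _ ≤ 2 * totalWeight w (expLabel (j + 1)) * (C * exp (-j)) := by gcongr
    _ = 2 * C * (totalWeight w (expLabel (j + 1)) * exp (-j)) := by ring

lemma LogLike.eventually_rpow_le_windowMass (hE : LogLike α E)
    (hb : Tendsto (fun j : ℕ => windowMass w j * exp (E j)) atTop (𝓝 1)) :
    ∀ᶠ j : ℕ in atTop, (j : ℝ) ^ (-(α + 1)) / 2 ≤ windowMass w j := by
  filter_upwards [hb.eventually_const_lt (show (1 / 2 : ℝ) < 1 by norm_num),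
    tendsto_natCast_atTop_atTop.eventually
      (hE.eventually_div_log_lt (c := α + 1) (by linarith)), eventually_ge_atTop 2]
    with j hmass hlt hj
  have one_lt : (1 : ℝ) < j := by exact_mod_cast hj
  rw [div_lt_iff₀ (Real.log_pos one_lt)] at hlt
  calc (j : ℝ) ^ (-(α + 1)) / 2 ≤ exp (-E j) / 2 := by
        rw [Real.rpow_def_of_pos (by linarith)]
        gcongr
        linarith
    _ ≤ windowMass w j * exp (E j) * exp (-E j) := by
        rw [div_eq_inv_mul, ← one_div]
        gcongr
    _ = windowMass w j := by
        rw [mul_assoc, ← Real.exp_add, add_neg_cancel, Real.exp_zero, mul_one]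

lemma exp_neg_add_logThreshold (hw : ∀ i, 1 ≤ i → 0 ≤ w i) (hw1 : 0 < w 1) {j : ℕ} (hj : 1 ≤ j) :
    exp (-j + logThreshold α w j) =
      totalWeight w (expLabel (j + 1)) * exp (-j) * (j : ℝ) ^ (2 * α + 5) := by
  rw [logThreshold, Real.exp_add, Real.exp_add,
    Real.exp_log (totalWeight_pos hw hw1 (one_le_expLabel (j + 1))),
    Real.rpow_def_of_pos (by exact_mod_cast hj), mul_comm (log (j : ℝ))]
  ring

variable {Ω : Type*} [MeasurableSpace Ω] {μ : Measure Ω} [IsProbabilityMeasure μ] {K : ℕ → Ω → ℕ}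

lemma IsWRT.exists_eventually_measureReal_le (hK : IsWRT μ w K) (hE : LogLike α E)
    (hw : ∀ i, 1 ≤ i → 0 ≤ w i) (hw1 : 0 < w 1)
    (hsum : Summable fun i : ℕ => w (i + 1) ^ 2 / totalWeight w (i + 1) ^ 2)
    (hsq : (fun n : ℕ => ∑' i : ℕ, w (n + i) ^ 2 / totalWeight w (n + i) ^ 2)
      =O[atTop] fun n : ℕ => 1 / (n : ℝ))
    (hb : Tendsto (fun j : ℕ => windowMass w j * exp (E j)) atTop (𝓝 1)) {η : ℝ} (hη : η < 1) :
    ∃ C : ℝ, ∀ᶠ j : ℕ in atTop, ∀ h, μ.real {ω |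
      exp (-j + logThreshold α w j) ≤ tallWeight w (fun i => K i ω) (expLabel j) h ∧
      tallWeight w (fun i => K i ω) (expLabel (j + 1)) (h + 1) <
        tallWeight w (fun i => K i ω) (expLabel j) (h + 1) +
          η * windowMass w j * tallWeight w (fun i => K i ω) (expLabel j) h} ≤
      C / (j : ℝ) ^ 3 := by
  obtain ⟨C, hC, hvariance⟩ := exists_eventually_sum_sq_window_le hw hw1 hsum hsq
  have hη' : 0 < 1 - η := sub_pos.2 hη
  refine ⟨4 * C / (1 - η) ^ 2, ?_⟩
  filter_upwards [hvariance, hE.eventually_rpow_le_windowMass hb, eventually_ge_atTop 1]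
    with j hV hmass hj h
  have hj0 : (0 : ℝ) < j := by exact_mod_cast hj
  have hmass0 : 0 < windowMass w j := lt_of_lt_of_le (by positivity) hmass
  set W := totalWeight w (expLabel (j + 1))
  have hW : 0 < W := totalWeight_pos hw hw1 (one_le_expLabel (j + 1))
  have rpow_mul_sq : (j : ℝ) ^ (2 * α + 5) * ((j : ℝ) ^ (-(α + 1)) / 2) ^ 2 = (j : ℝ) ^ 3 / 4 := by
    rw [div_pow, ← Real.rpow_mul_natCast hj0.le, ← mul_div_assoc, ← Real.rpow_add hj0,
      show 2 * α + 5 + -(α + 1) * (2 : ℕ) = (3 : ℕ) by push_cast; ring, Real.rpow_natCast]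
    norm_num
  have denominator_ge : W * exp (-j) * ((1 - η) ^ 2 * ((j : ℝ) ^ 3 / 4)) ≤
      exp (-j + logThreshold α w j) * ((1 - η) * windowMass w j) ^ 2 :=
    calc W * exp (-j) * ((1 - η) ^ 2 * ((j : ℝ) ^ 3 / 4))
        = W * exp (-j) * (j : ℝ) ^ (2 * α + 5) * ((1 - η) * ((j : ℝ) ^ (-(α + 1)) / 2)) ^ 2 := by
          rw [← rpow_mul_sq]
          ring
      _ ≤ W * exp (-j) * (j : ℝ) ^ (2 * α + 5) * ((1 - η) * windowMass w j) ^ 2 := by gcongr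
      _ = _ := by rw [exp_neg_add_logThreshold hw hw1 hj]
  calc _ ≤ _ := hK.measureReal_tallWeight_lt_le hw hw1 (one_le_expLabel j) h
        (expLabel_mono j.le_succ) (Real.exp_pos _) hη hmass0
    _ ≤ C * (W * exp (-j)) / (W * exp (-j) * ((1 - η) ^ 2 * ((j : ℝ) ^ 3 / 4))) :=
        div_le_div₀ (by positivity) hV (by positivity) denominator_ge
    _ = 4 * C / (1 - η) ^ 2 / (j : ℝ) ^ 3 := by
        field_simp

lemma IsWRT.ae_isGrowthArray (hK : IsWRT μ w K) (hE : LogLike α E)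
    (hw : ∀ i, 1 ≤ i → 0 ≤ w i) (hw1 : 0 < w 1)
    (hsum : Summable fun i : ℕ => w (i + 1) ^ 2 / totalWeight w (i + 1) ^ 2)
    (hsq : (fun n : ℕ => ∑' i : ℕ, w (n + i) ^ 2 / totalWeight w (n + i) ^ 2)
      =O[atTop] fun n : ℕ => 1 / (n : ℝ))
    (hb : Tendsto (fun j : ℕ => windowMass w j * exp (E j)) atTop (𝓝 1)) {η : ℝ} (hη : η < 1) :
    ∀ᵐ ω ∂μ, IsGrowthArray (windowMass w) (logThreshold α w) η
      fun j h => tallWeight w (fun i => K i ω) (expLabel j) h := by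
  obtain ⟨C, hC⟩ := hK.exists_eventually_measureReal_le hE hw hw1 hsum hsq hb hη
  filter_upwards [ae_eventually_forall_le_notMem hC] with ω hω
  refine ⟨fun j h => tallWeight_mono hw h (expLabel_mono j.le_succ),
    fun j h => tallWeight_nonneg hw _ h, ?_⟩
  filter_upwards [hω] with j hj h hh hle
  by_contra hlt
  exact hj h hh ⟨hle, not_le.1 hlt⟩

theorem IsWRT.ae_eventually_profile_le (hK : IsWRT μ w K) (hE : LogLike α E) (hα : 0 < α)
    (hw : ∀ i, 1 ≤ i → 0 ≤ w i) (hw1 : 0 < w 1)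
    (hsum : Summable fun i : ℕ => w (i + 1) ^ 2 / totalWeight w (i + 1) ^ 2)
    (hsq : (fun n : ℕ => ∑' i : ℕ, w (n + i) ^ 2 / totalWeight w (n + i) ^ 2)
      =O[atTop] fun n : ℕ => 1 / (n : ℝ))
    (hb : Tendsto (fun j : ℕ => windowMass w j * exp (E j)) atTop (𝓝 1)) {c : ℝ} (hc : 0 < c) :
    ∀ᵐ ω ∂μ, ∀ᶠ n : ℕ in atTop,
      profile α E (-c) (log n) ≤ treeHeight (fun i => K i ω) n := by
  obtain ⟨η, -, hη, hprofile⟩ := IsGrowthArray.exists_eventually_profile_le hE hα hc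
  have totalWeight_ge (j : ℕ) : w 1 ≤ totalWeight w (expLabel j) := by
    simpa [totalWeight] using totalWeight_mono hw (one_le_expLabel j)
  filter_upwards [hK.ae_isGrowthArray hE hw hw1 hsum hsq hb hη] with ω hω
  have exists_height := hprofile _ _ _ (w 1) hb
    (hE.slowlyIncreasing_logThreshold hα hw hw1 hsum hb) hω hw1
    (Eventually.of_forall fun j => (totalWeight_ge j).trans_eq (tallWeight_zero w _ _).symm)
  filter_upwards [tendsto_log_natCast.eventually exists_height, eventually_ge_atTop 1]
    with n ⟨h, hheight, hpos⟩ hn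
  refine hheight.trans ?_
  exact_mod_cast le_treeHeight_of_tallWeight_pos
    (hpos.trans_le (tallWeight_mono hw h (expLabel_floor_log_le hn)))

end LowerBound

/-! ### The upper bound -/

lemma summable_one_div_mul_log_sq : Summable fun n : ℕ => 1 / ((n : ℝ) * log n ^ 2) := by
  refine (summable_condensed_iff_of_eventually_nonneg ?_ ?_).1 ?_
  · exact Eventually.of_forall fun n => by
      rw [Pi.zero_apply]
      positivity
  · filter_upwards [eventually_ge_atTop 2] with n hn
    have one_lt : (1 : ℝ) < n := by exact_mod_cast hn
    have log_pos := Real.log_pos one_lt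
    have le_succ : (n : ℝ) ≤ (n + 1 : ℕ) := by exact_mod_cast n.le_succ
    have log_le := Real.log_le_log (by linarith) le_succ
    gcongr
  · refine ((Real.summable_nat_pow_inv.2 one_lt_two).mul_left ((log 2 ^ 2)⁻¹)).congr fun k => ?_
    push_cast
    rw [Real.log_pow]
    field_simp

section MomentExponent

variable {w f : ℕ → ℝ}

lemma momentExponent_mono (hw : ∀ i, 1 ≤ i → 0 ≤ w i) (hw1 : 0 < w 1) (hf : ∀ i, 0 ≤ f i) :
    Monotone (momentExponent w f) := fun n N hnN => by
  refine Finset.sum_le_sum_of_subset_of_nonneg (Finset.Icc_subset_Icc_right hnN) fun i hi _ => ?_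
  have hi1 : 1 ≤ i := one_le_two.trans (Finset.mem_Icc.1 hi).1
  exact mul_nonneg (sub_nonneg.2 (Real.one_le_exp (hf i)))
    (div_nonneg (hw i hi1) (totalWeight_pos hw hw1 hi1).le)

lemma momentExponent_sub_le (hw : ∀ i, 1 ≤ i → 0 ≤ w i) (hw1 : 0 < w 1) {n N : ℕ} {B : ℝ}
    (hn : 1 ≤ n) (hnN : n ≤ N) (hf : ∀ i ∈ Set.Ioc n N, f i ≤ B) :
    momentExponent w f N - momentExponent w f n ≤ exp B * (aSeq w N - aSeq w n) := by
  induction N, hnN using Nat.le_induction with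
  | base => simp
  | succ N hnN ih =>
    have share_nonneg : 0 ≤ w (N + 1) / totalWeight w (N + 1) :=
      div_nonneg (hw _ (by omega)) (totalWeight_pos hw hw1 (by omega)).le
    have exp_le : exp (f (N + 1)) - 1 ≤ exp B := by
      linarith [Real.exp_le_exp.2 (hf (N + 1) ⟨by omega, le_rfl⟩)]
    rw [momentExponent_succ w f (hn.trans hnN), aSeq_succ]
    linarith [ih fun i hi => hf i ⟨hi.1, hi.2.trans N.le_succ⟩,
      mul_le_mul_of_nonneg_right exp_le share_nonneg]

lemma IsWRT.measureReal_le_pathSum_le {Ω : Type*} [MeasurableSpace Ω] {μ : Measure Ω}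
    [IsProbabilityMeasure μ] {K : ℕ → Ω → ℕ} (hK : IsWRT μ w K) (hw : ∀ i, 1 ≤ i → 0 ≤ w i)
    (hw1 : 0 < w 1) (f : ℕ → ℝ) {n : ℕ} (hn : 1 ≤ n) (B : ℝ) :
    μ.real {ω | B ≤ pathSum f (fun i => K i ω) (n + 1)} ≤
      exp (f (n + 1) + momentExponent w f n - B) := by
  have integrable_exp : Integrable (fun ω => exp (pathSum f (fun i => K i ω) (n + 1))) μ :=
    hK.integrable (Real.measurable_exp.comp (hK.measurable_pathSum f (by omega) le_rfl))
  have markov := mul_meas_ge_le_integral_of_nonneg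
    (Eventually.of_forall fun ω => (Real.exp_pos _).le) integrable_exp (exp B)
  simp only [Real.exp_le_exp] at markov
  rw [Real.exp_sub, le_div_iff₀' (Real.exp_pos B)]
  exact markov.trans (hK.integral_exp_pathSum_le hw hw1 f hn)

end MomentExponent

section UpperBound

variable {α : ℝ} {E : ℝ → ℝ} {w : ℕ → ℝ}

lemma eventually_mul_sub_le_sub_div_mul_log (hα : 0 < α) {κ : ℝ} (hκ : 0 ≤ κ) (hκ1 : κ < 1) :
    ∀ᶠ x in atTop, ∀ x' y, x ≤ x' → x' ≤ y →
      κ / (α * log y) * (x' - x) ≤ x' / (α * log x') - x / (α * log x) := by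
  have tendsto_one : Tendsto (fun t => 1 - 1 / log t) atTop (𝓝 1) := by
    simpa using tendsto_const_nhds.sub tendsto_one_div_log
  obtain ⟨X, hX⟩ := ((tendsto_one.eventually_const_lt hκ1).and
    (eventually_gt_atTop 1)).exists_forall_of_atTop
  filter_upwards [eventually_ge_atTop X] with x hx x' y hx' hy
  have hasDerivAt : ∀ t ∈ Set.Icc x x', HasDerivAt (fun x => x / (α * log x))
      ((1 - 1 / log t) / (α * log t)) t := fun t ht =>
    hasDerivAt_div_mul_log hα (hX t (hx.trans ht.1)).2
  refine (convex_Icc x x').mul_sub_le_image_sub_of_le_deriv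
    (fun t ht => (hasDerivAt t ht).continuousAt.continuousWithinAt)
    (fun t ht => (hasDerivAt t (interior_subset ht)).differentiableAt.differentiableWithinAt)
    (fun t ht => ?_) x (Set.left_mem_Icc.2 hx') x' (Set.right_mem_Icc.2 hx') hx'
  have ht' := interior_subset ht
  obtain ⟨slope_gt, one_lt⟩ := hX t (hx.trans ht'.1)
  have log_pos := Real.log_pos one_lt
  have log_le : log t ≤ log y := Real.log_le_log (by linarith) (ht'.2.trans hy)
  have slope_nonneg := hκ.trans slope_gt.le
  rw [(hasDerivAt t ht').deriv]
  gcongr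

lemma exists_eventually_le_mul_div_mul_log {T : ℕ → ℝ} (hα : 0 < α) {a b : ℝ} (ha : 0 ≤ a)
    (hab : a < b) (hT : Monotone T)
    (hwindow : ∀ᶠ j in atTop, T (expLabel (j + 1)) - T (expLabel j) ≤
      a / (α * log (log (expLabel (j + 1))))) :
    ∃ C, ∀ᶠ n : ℕ in atTop, T n ≤ b * (log n / (α * log (log n))) + C := by
  have hb : 0 < b := ha.trans_lt hab
  set F : ℝ → ℝ := fun x => b * (x / (α * log x))
  have increment_ge : ∀ᶠ x in atTop, ∀ x' y, x ≤ x' → x' ≤ y →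
      a / (α * log y) * (x' - x) ≤ F x' - F x := by
    filter_upwards [eventually_mul_sub_le_sub_div_mul_log hα (div_nonneg ha hb.le)
      ((div_lt_one hb).2 hab)] with x hx x' y hx' hy
    calc a / (α * log y) * (x' - x) = b * (a / b / (α * log y) * (x' - x)) := by field_simp
      _ ≤ F x' - F x := (mul_le_mul_of_nonneg_left (hx x' y hx' hy) hb.le).trans_eq (mul_sub _ _ _)
  obtain ⟨J, hJ⟩ := ((tendsto_natCast_atTop_atTop.eventually increment_ge).and
    hwindow).exists_forall_of_atTop
  have expLabel_le : ∀ j, J ≤ j → T (expLabel (j + 1)) ≤ F j + (T (expLabel (J + 1)) - F J) := by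
    refine Nat.le_induction (by simp) fun j hj ih => ?_
    have hlabel : ((j + 1 : ℕ) : ℝ) ≤ log (expLabel (j + 1 + 1)) :=
      le_trans (by exact_mod_cast Nat.le_succ _) (le_log_expLabel _)
    have hF_step := (hJ j hj).1 (j + 1 : ℕ) _ (by exact_mod_cast j.le_succ) hlabel
    push_cast at hF_step ⊢
    rw [add_sub_cancel_left, mul_one] at hF_step
    linarith [(hJ (j + 1) (by omega)).2]
  refine ⟨T (expLabel (J + 1)) - F J, ?_⟩
  filter_upwards [tendsto_log_natCast.eventually_ge_atTop (J : ℝ),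
    tendsto_log_natCast.eventually_ge_atTop 1, eventually_ge_atTop 1] with n hnJ hlog hn
  have floor_le : (⌊log n⌋₊ : ℝ) ≤ log n := Nat.floor_le (by linarith)
  have hfloor := Nat.le_floor hnJ
  have F_floor_le := (hJ _ hfloor).1 _ _ floor_le le_rfl
  have loglog_nonneg := Real.log_nonneg hlog
  have slope_nonneg : 0 ≤ a / (α * log (log n)) * (log n - ⌊log n⌋₊) :=
    mul_nonneg (by positivity) (sub_nonneg.2 floor_le)
  calc T n ≤ T (expLabel (⌊log n⌋₊ + 1)) := hT (le_expLabel_floor_log hn)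
    _ ≤ F (⌊log n⌋₊ : ℝ) + (T (expLabel (J + 1)) - F J) := expLabel_le _ hfloor
    _ ≤ F (log n) + (T (expLabel (J + 1)) - F J) := by linarith

lemma labelCost_of_lt (α : ℝ) (E : ℝ → ℝ) {n₀ i : ℕ} (h : n₀ < i) :
    labelCost α E n₀ i = cost α E (log i) :=
  Set.indicator_of_mem (Set.mem_Ioi.2 h) _

namespace LogLike

lemma eventually_labelCost_nonneg (hE : LogLike α E) (hα : 0 < α) :
    ∀ᶠ n₀ in atTop, ∀ i, 0 ≤ labelCost α E n₀ i := by
  filter_upwards [eventually_forall_ge_atTop.2 (tendsto_log_natCast.eventually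
    ((hE.logLike_cost.tendsto_atTop hα).eventually_ge_atTop 0))] with n₀ hn₀
  exact Set.indicator_nonneg fun i hi => hn₀ i (Set.mem_Ioi.1 hi).le

lemma eventually_exp_cost_mul_windowMass_le (hE : LogLike α E) (hα : 0 < α)
    (hb : Tendsto (fun j : ℕ => windowMass w j * exp (E j)) atTop (𝓝 1)) {a : ℝ} (ha : 1 < a) :
    ∀ᶠ j : ℕ in atTop, exp (cost α E (log (expLabel (j + 1)))) * windowMass w j ≤
      a / (α * log (log (expLabel (j + 1)))) := by
  have E_sub := hE.tendsto_sub_natCast (x := fun j => log (expLabel (j + 1)))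
    (Eventually.of_forall fun j => le_trans (by simp) (le_log_expLabel (j + 1)))
    (Eventually.of_forall fun j => (log_expLabel_le_add_one (j + 1)).trans_eq (by push_cast; ring))
  have mass_mul := hb.mul ((Real.continuous_exp.tendsto _).comp E_sub)
  rw [Real.exp_zero, mul_one] at mass_mul
  filter_upwards [mass_mul.eventually_lt_const ha, eventually_ge_atTop 1] with j hj hj1
  have one_lt : 1 < log (expLabel (j + 1)) :=
    lt_of_lt_of_le (by exact_mod_cast Nat.lt_succ_of_le hj1) (le_log_expLabel (j + 1))
  have loglog_pos := Real.log_pos one_lt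
  rw [Function.comp_apply, mul_assoc, ← Real.exp_add, add_sub_cancel] at hj
  rw [le_div_iff₀ (by positivity), cost, Real.exp_sub, Real.exp_sub, Real.exp_log loglog_pos,
    Real.exp_log hα]
  refine le_trans (le_of_eq ?_) hj.le
  field_simp

lemma eventually_momentExponent_window_le (hE : LogLike α E) (hα : 0 < α)
    (hw : ∀ i, 1 ≤ i → 0 ≤ w i) (hw1 : 0 < w 1)
    (hb : Tendsto (fun j : ℕ => windowMass w j * exp (E j)) atTop (𝓝 1)) {a : ℝ} (ha : 1 < a)
    (n₀ : ℕ) :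
    ∀ᶠ j in atTop, momentExponent w (labelCost α E n₀) (expLabel (j + 1)) -
      momentExponent w (labelCost α E n₀) (expLabel j) ≤
        a / (α * log (log (expLabel (j + 1)))) := by
  filter_upwards [hE.eventually_exp_cost_mul_windowMass_le hα hb ha,
    tendsto_expLabel.eventually_ge_atTop n₀, tendsto_expLabel.eventually
      (tendsto_log_natCast.eventually (hE.logLike_cost.eventually_monotoneOn hα))]
    with j mass_le hn₀ cost_mono
  have label_mono := monotoneOn_comp_log_natCast (one_le_expLabel j) cost_mono
  refine (momentExponent_sub_le hw hw1 (one_le_expLabel j) (expLabel_mono j.le_succ)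
    fun i hi => ?_).trans mass_le
  rw [labelCost_of_lt α E (hn₀.trans_lt hi.1)]
  exact label_mono hi.1.le (expLabel_mono j.le_succ) hi.2

lemma exists_eventually_momentExponent_le (hE : LogLike α E) (hα : 0 < α)
    (hw : ∀ i, 1 ≤ i → 0 ≤ w i) (hw1 : 0 < w 1)
    (hb : Tendsto (fun j : ℕ => windowMass w j * exp (E j)) atTop (𝓝 1)) {b : ℝ} (hb1 : 1 < b)
    {n₀ : ℕ} (hn₀ : ∀ i, 0 ≤ labelCost α E n₀ i) :
    ∃ C, ∀ᶠ n : ℕ in atTop, momentExponent w (labelCost α E n₀) n ≤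
      b * (log n / (α * log (log n))) + C := by
  obtain ⟨a, ha1, hab⟩ := exists_between hb1
  exact exists_eventually_le_mul_div_mul_log hα (zero_le_one.trans ha1.le) hab
    (momentExponent_mono hw hw1 hn₀)
    (hE.eventually_momentExponent_window_le hα hw hw1 hb ha1 n₀)

lemma eventually_cost_add_sub_barrier_le (hE : LogLike α E) (hα : 0 < α) {b ε : ℝ}
    (hb : b < 1 + ε) (C : ℝ) :
    ∀ᶠ x in atTop, cost α E x + (b * (x / (α * log x)) + C) - barrier α ε x ≤
      -x - 2 * log x := by
  have tendsto_zero : Tendsto (fun x : ℝ => (α + 3) * (α * (log x ^ 2 / x)) + C * α * (log x / x))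
      atTop (𝓝 0) := by
    simpa using (((Real.isLittleO_pow_log_id_atTop (n := 2)).tendsto_div_nhds_zero.const_mul
      α).const_mul (α + 3)).add
        (Real.isLittleO_log_id_atTop.tendsto_div_nhds_zero.const_mul (C * α))
  filter_upwards [tendsto_zero.eventually_lt_const (sub_pos.2 hb), eventually_gt_atTop 1,
    hE.logLike_cost.eventually_div_log_lt (c := α + 1) (by linarith)] with x hx hx1 cost_lt
  have hlog := Real.log_pos hx1
  have hx0 : 0 < x := by linarith
  rw [div_lt_iff₀ hlog] at cost_lt
  have log_le : (α + 3) * log x + C ≤ (1 + ε - b) * (x / (α * log x)) :=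
    calc (α + 3) * log x + C
        = ((α + 3) * (α * (log x ^ 2 / x)) + C * α * (log x / x)) * (x / (α * log x)) := by
          field_simp
      _ ≤ (1 + ε - b) * (x / (α * log x)) := by gcongr
  rw [barrier]
  linarith

end LogLike

lemma exp_neg_log_sub_two_mul_log_log {n : ℝ} (hn : 1 < n) :
    exp (-log n - 2 * log (log n)) = 1 / (n * log n ^ 2) := by
  have hlog := Real.log_pos hn
  rw [← Real.log_rpow hlog, Real.exp_sub, Real.exp_neg, Real.exp_log (by linarith),
    Real.exp_log (by positivity), Real.rpow_two]
  field_simp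

variable {Ω : Type*} [MeasurableSpace Ω] {μ : Measure Ω} [IsProbabilityMeasure μ] {K : ℕ → Ω → ℕ}

lemma IsWRT.eventually_measureReal_barrier_le_pathSum_le (hK : IsWRT μ w K) (hE : LogLike α E)
    (hα : 0 < α) (hw : ∀ i, 1 ≤ i → 0 ≤ w i) (hw1 : 0 < w 1)
    (hb : Tendsto (fun j : ℕ => windowMass w j * exp (E j)) atTop (𝓝 1)) {ε : ℝ} (hε : 0 < ε)
    {n₀ : ℕ} (hn₀ : ∀ i, 0 ≤ labelCost α E n₀ i) :
    ∀ᶠ n : ℕ in atTop,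
      μ.real {ω | barrier α ε (log n) ≤ pathSum (labelCost α E n₀) (fun i => K i ω) n} ≤
        1 / ((n : ℝ) * log n ^ 2) := by
  obtain ⟨b, hb1, hbε⟩ := exists_between (show 1 < 1 + ε by linarith)
  obtain ⟨C, hC⟩ := hE.exists_eventually_momentExponent_le hα hw hw1 hb hb1 hn₀
  filter_upwards [hC, tendsto_log_natCast.eventually
    (hE.eventually_cost_add_sub_barrier_le hα hbε C), eventually_gt_atTop n₀,
    eventually_ge_atTop 2] with n moment_le exponent_le hn hn2
  obtain ⟨k, rfl⟩ : ∃ k, n = k + 1 := ⟨n - 1, by omega⟩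
  refine (hK.measureReal_le_pathSum_le hw hw1 _ (by omega) _).trans ?_
  rw [← exp_neg_log_sub_two_mul_log_log (by exact_mod_cast hn2), labelCost_of_lt α E hn]
  refine Real.exp_le_exp.2 (le_trans ?_ exponent_le)
  linarith [momentExponent_mono hw hw1 hn₀ k.le_succ]

theorem IsWRT.ae_eventually_le_profile (hK : IsWRT μ w K) (hE : LogLike α E) (hα : 0 < α)
    (hw : ∀ i, 1 ≤ i → 0 ≤ w i) (hw1 : 0 < w 1)
    (hb : Tendsto (fun j : ℕ => windowMass w j * exp (E j)) atTop (𝓝 1)) {c : ℝ} (hc : 0 < c) :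
    ∀ᵐ ω ∂μ, ∀ᶠ n : ℕ in atTop, (treeHeight (fun i => K i ω) n : ℝ) ≤ profile α E c (log n) := by
  obtain ⟨ε, hε, hεc⟩ := exists_between hc
  obtain ⟨n₀, height_le, cost_nonneg⟩ :=
    ((hE.eventually_treeHeight_le hα hε hεc).and (hE.eventually_labelCost_nonneg hα)).exists
  filter_upwards [ae_eventually_notMem_of_summable summable_one_div_mul_log_sq
    (hK.eventually_measureReal_barrier_le_pathSum_le hE hα hw hw1 hb hε cost_nonneg)] with ω hω
  have pathSum_bounded : IsBoundedUnder (· ≤ ·) atTop fun m : ℕ =>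
      pathSum (labelCost α E n₀) (fun i => K i ω) m - barrier α ε (log m) :=
    isBoundedUnder_of_eventually_le (a := 0) (hω.mono fun m hm => sub_nonpos.2 (not_le.1 hm).le)
  obtain ⟨C, hC⟩ := pathSum_bounded.bddAbove_range
  refine height_le _ (hK.isParentMap ω) C fun m _ => ?_
  linarith [show _ ≤ C from hC ⟨m, rfl⟩]

end UpperBound

/-! ### Expansion of the height -/

/-- The function `E` for which `e^{-E(x)} = x^{-α} L(x)` on `[1, ∞)`. -/
def negLogDensity (α : ℝ) (L : ℝ → ℝ) (x : ℝ) : ℝ := α * log x - log (L x)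

namespace SV

variable {L : ℝ → ℝ}

lemma mono {k l : ℕ} (hL : SV l L) (hkl : k ≤ l) : SV k L :=
  ⟨fun i hi => hL.1 i (hi.trans_le hkl), fun i hi => hL.2 i ⟨hi.1, hi.2.trans hkl⟩⟩

lemma differentiableOn (hL : SV 1 L) : DifferentiableOn ℝ L (Set.Ici 1) := by
  simpa only [iteratedDerivWithin_zero] using hL.1 0 one_pos

lemma logLike_log (hL : SV 1 L) (hL_pos : ∀ x, 1 ≤ x → 0 < L x) :
    LogLike 0 (fun x => log (L x)) := by
  have differentiableAt {t : ℝ} (ht : 1 < t) : DifferentiableAt ℝ L t :=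
    hL.differentiableOn.differentiableAt (Ici_mem_nhds ht)
  refine ⟨?_, (hL.2 1 ⟨le_rfl, le_rfl⟩).congr' ?_⟩
  · filter_upwards [eventually_gt_atTop 1] with t ht
    exact (differentiableAt ht).log (hL_pos t ht.le).ne'
  · filter_upwards [eventually_gt_atTop 1] with t ht
    rw [iteratedDerivWithin_one, derivWithin_of_mem_nhds (Ici_mem_nhds ht), pow_one,
      deriv.log (differentiableAt ht) (hL_pos t ht.le).ne', mul_div_assoc]

lemma logLike_negLogDensity (hL : SV 1 L) (hL_pos : ∀ x, 1 ≤ x → 0 < L x) (α : ℝ) :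
    LogLike α (negLogDensity α L) := by
  have sub_log := (logLike_mul_log α).sub (hL.logLike_log hL_pos)
  rwa [sub_zero] at sub_log

lemma continuousOn_negLogDensity (hL : SV 1 L) (hL_pos : ∀ x, 1 ≤ x → 0 < L x) (α : ℝ) :
    ContinuousOn (negLogDensity α L) (Set.Ici 1) :=
  (continuousOn_const.mul (Real.continuousOn_log.mono fun _ hx =>
    (zero_lt_one.trans_le hx).ne')).sub
      (hL.differentiableOn.continuousOn.log fun x hx => (hL_pos x hx).ne')

end SV

lemma exp_neg_negLogDensity {L : ℝ → ℝ} (α : ℝ) {x : ℝ} (hx : 0 < x) (hLx : 0 < L x) :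
    exp (-negLogDensity α L x) = x ^ (-α) * L x := by
  rw [negLogDensity, neg_sub, sub_eq_neg_add, Real.exp_add, Real.exp_log hLx,
    Real.rpow_def_of_pos hx, mul_neg, mul_comm α]

lemma SV.tendsto_windowMass_mul_exp {α : ℝ} {L : ℝ → ℝ} {w : ℕ → ℝ} (hL : SV 1 L)
    (hL_pos : ∀ x, 1 ≤ x → 0 < L x)
    (ha : (fun n : ℕ => aSeq w n - ∫ x in (1 : ℝ)..log n, x ^ (-α) * L x)
      =o[atTop] fun n : ℕ => log n ^ (-α) * L (log n)) :
    Tendsto (fun j : ℕ => windowMass w j * exp (negLogDensity α L j)) atTop (𝓝 1) := by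
  have density {x : ℝ} (hx : 1 ≤ x) := exp_neg_negLogDensity α (by linarith) (hL_pos x hx)
  refine (hL.logLike_negLogDensity hL_pos α).tendsto_windowMass_mul_exp
    (hL.continuousOn_negLogDensity hL_pos α) (ha.congr' ?_ ?_)
  all_goals filter_upwards [tendsto_log_natCast.eventually_ge_atTop 1] with n hn
  · congr 1
    refine intervalIntegral.integral_congr fun x hx => (density ?_).symm
    rw [Set.uIcc_of_le hn] at hx
    exact hx.1
  · exact (density hn).symm

lemma isLittleO_rpow_neg_one_sub_mul_log_sq_mul (α : ℝ) (L : ℝ → ℝ) :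
    (fun x : ℝ => x ^ (-1 - α) * log x ^ 2 * L x) =o[atTop] fun x => x ^ (-α) * L x := by
  have log_sq_div : (fun x : ℝ => log x ^ 2 / x) =o[atTop] fun _ => (1 : ℝ) :=
    (isLittleO_one_iff ℝ).2 (Real.isLittleO_pow_log_id_atTop (n := 2)).tendsto_div_nhds_zero
  refine (log_sq_div.mul_isBigO (isBigO_refl (fun x : ℝ => x ^ (-α) * L x) atTop)).congr' ?_
    (Eventually.of_forall fun x => one_mul _)
  filter_upwards [eventually_gt_atTop 0] with x hx
  rw [sub_eq_add_neg, Real.rpow_add hx, Real.rpow_neg_one]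
  ring

section Expansion

variable {α : ℝ} {L : ℝ → ℝ}

lemma hasSum_seriesTerm {n : ℕ} (hratio : |log (L (log n)) / (α * log (log n))| < 1) :
    HasSum (seriesTerm α L n)
      (log (L (log n)) / (1 - log (L (log n)) / (α * log (log n))) +
        log (log (log n)) / (1 - log (L (log n)) / (α * log (log n))) ^ 2) := by
  set l := log (L (log n))
  set u := l / (α * log (log n))
  set v := log (log (log n))
  have hne : 1 - u ≠ 0 := (sub_pos.2 (abs_lt.1 hratio).2).ne'
  have hsum : l / (1 - u) + v / (1 - u) ^ 2 = (l + v) * (1 - u)⁻¹ + v * (u / (1 - u) ^ 2) := by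
    field_simp
    ring
  rw [hsum]
  refine (((hasSum_geometric_of_norm_lt_one hratio).mul_left (l + v)).add
    ((hasSum_coe_mul_geometric_of_norm_lt_one hratio).mul_left v)).congr_fun fun k => ?_
  change u ^ k * (l + ((k : ℝ) + 1) * v) = _
  ring

lemma SV.eventually_abs_log_div_lt_one (hL : SV 1 L) (hL_pos : ∀ x, 1 ≤ x → 0 < L x) (α : ℝ) :
    ∀ᶠ n : ℕ in atTop, |log (L (log n)) / (α * log (log n))| < 1 := by
  have tendsto_zero := ((hL.logLike_log hL_pos).tendsto_div_log.div_const α).abs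
  rw [zero_div, abs_zero] at tendsto_zero
  filter_upwards [tendsto_log_natCast.eventually (tendsto_zero.eventually_lt_const one_pos)]
    with n hn
  rwa [mul_comm, ← div_div]

lemma tendsto_sq_log_log_add_div (a : ℝ) :
    Tendsto (fun x => (log (log x) + a) ^ 2 / log x) atTop (𝓝 0) := by
  have log_sq_div := (Real.isLittleO_pow_log_id_atTop (n := 2)).tendsto_div_nhds_zero
  have log_div := Real.isLittleO_log_id_atTop.tendsto_div_nhds_zero
  have const_div : Tendsto (fun y : ℝ => a ^ 2 / y) atTop (𝓝 0) :=
    tendsto_const_nhds.div_atTop tendsto_id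
  have tendsto_add := (log_sq_div.add (log_div.const_mul (2 * a))).add const_div
  rw [mul_zero, add_zero, add_zero] at tendsto_add
  refine (tendsto_add.comp Real.tendsto_log_atTop).congr fun x => ?_
  simp only [Function.comp, id]
  ring

-- Here `Λ = α log x`, `l = log (L x)`, `v = log (log x)` and `a = log α`, so that the denominator
-- `Λ - l - v - a` is `cost`.
lemma expansion_remainder_eq {x Λ l v a α : ℝ} (hx : x ≠ 0) (hΛ : Λ ≠ 0) (hΛl : Λ - l ≠ 0)
    (hcost : Λ - l - v - a ≠ 0) :
    (x / (Λ - l - v - a) + (1 + α + 0) * (x / Λ ^ 2) - x / Λ) / (x / Λ ^ 2) -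
        (l / (1 - l / Λ) + v / (1 - l / Λ) ^ 2 + 1 + α + a) =
      (Λ / (Λ - l)) ^ 2 * ((v + a) ^ 2 / (Λ - l - v - a)) + a * ((Λ / (Λ - l)) ^ 2 - 1) := by
  rw [show 1 - l / Λ = (Λ - l) / Λ by field_simp]
  obtain ⟨D, rfl⟩ : ∃ D, l = Λ - (D + v + a) := ⟨Λ - l - v - a, by ring⟩
  have cost_eq : Λ - (Λ - (D + v + a)) - v - a = D := by ring
  have sub_eq : Λ - (Λ - (D + v + a)) = D + v + a := by ring
  rw [cost_eq] at hcost ⊢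
  rw [sub_eq] at hΛl ⊢
  field_simp
  ring

lemma LogLike.tendsto_expansion_remainder {E : ℝ → ℝ} (hE : LogLike α E) (hα : 0 < α) (a : ℝ) :
    Tendsto (fun x => (α * log x / E x) ^ 2 * ((log (log x) + a) ^ 2 / cost α E x) +
      a * ((α * log x / E x) ^ 2 - 1)) atTop (𝓝 0) := by
  have ratio_sq := (hE.tendsto_mul_log_div hα).pow 2
  have sq_div_cost :=
    (tendsto_sq_log_log_add_div a).mul (hE.logLike_cost.tendsto_mul_log_div hα)
  have tendsto_add := (ratio_sq.mul (sq_div_cost.const_mul α⁻¹)).add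
    ((ratio_sq.sub_const 1).const_mul a)
  simp only [zero_mul, mul_zero, one_pow, sub_self, add_zero] at tendsto_add
  refine tendsto_add.congr' ?_
  filter_upwards [eventually_gt_atTop 1] with x hx
  have hlog := Real.log_pos hx
  congr 2
  field_simp

lemma SV.tendsto_profile_sub_tsum_seriesTerm (hL : SV 1 L) (hL_pos : ∀ x, 1 ≤ x → 0 < L x)
    (hα : 0 < α) :
    Tendsto (fun n : ℕ => (profile α (negLogDensity α L) 0 (log n) - log n / (α * log (log n))) /
        (log n / (α * log (log n)) ^ 2) - ((∑' k, seriesTerm α L n k) + 1 + α + log α))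
      atTop (𝓝 0) := by
  have hE := hL.logLike_negLogDensity hL_pos α
  refine ((hE.tendsto_expansion_remainder hα (log α)).comp tendsto_log_natCast).congr' ?_
  filter_upwards [hL.eventually_abs_log_div_lt_one hL_pos α,
    tendsto_log_natCast.eventually_gt_atTop 1,
    tendsto_log_natCast.eventually ((hE.tendsto_atTop hα).eventually_gt_atTop 0),
    tendsto_log_natCast.eventually ((hE.logLike_cost.tendsto_atTop hα).eventually_gt_atTop 0)]
    with n hratio one_lt E_pos cost_pos
  have loglog_pos := Real.log_pos one_lt
  rw [(hasSum_seriesTerm hratio).tsum_eq, profile]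
  exact (expansion_remainder_eq (by linarith) (by positivity) E_pos.ne' cost_pos.ne').symm

end Expansion

section Fluctuation

variable {α : ℝ} {E : ℝ → ℝ}

lemma eventually_div_mul_log_log_sq_pos (hα : 0 < α) :
    ∀ᶠ n : ℕ in atTop, 0 < log n / (α * log (log n)) ^ 2 := by
  filter_upwards [tendsto_log_natCast.eventually_gt_atTop 1] with n hn
  have loglog_pos := Real.log_pos hn
  exact div_pos (zero_lt_one.trans hn) (by positivity)

lemma tendsto_sub_profile_div {H : ℕ → ℝ} (hα : 0 < α)
    (hlower : ∀ q : ℕ, ∀ᶠ n : ℕ in atTop, profile α E (-(1 / (q + 1))) (log n) ≤ H n)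
    (hupper : ∀ q : ℕ, ∀ᶠ n : ℕ in atTop, H n ≤ profile α E (1 / (q + 1)) (log n)) :
    Tendsto (fun n : ℕ => (H n - profile α E 0 (log n)) / (log n / (α * log (log n)) ^ 2))
      atTop (𝓝 0) := by
  rw [Metric.tendsto_nhds]
  intro δ hδ
  obtain ⟨q, hq⟩ := exists_nat_one_div_lt hδ
  filter_upwards [hlower q, hupper q, eventually_div_mul_log_log_sq_pos hα]
    with n lower upper scale_pos
  rw [Real.dist_eq, sub_zero]
  refine lt_of_le_of_lt ?_ hq
  rw [abs_le, le_div_iff₀ scale_pos, div_le_iff₀ scale_pos]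
  simp only [profile] at lower upper ⊢
  constructor <;> linarith

theorem IsWRT.ae_tendsto_treeHeight_sub_profile_div {Ω : Type*} [MeasurableSpace Ω] {μ : Measure Ω}
    [IsProbabilityMeasure μ] {K : ℕ → Ω → ℕ} {w : ℕ → ℝ} (hK : IsWRT μ w K) (hE : LogLike α E)
    (hα : 0 < α) (hw : ∀ i, 1 ≤ i → 0 ≤ w i) (hw1 : 0 < w 1)
    (hsum : Summable fun i : ℕ => w (i + 1) ^ 2 / totalWeight w (i + 1) ^ 2)
    (hsq : (fun n : ℕ => ∑' i : ℕ, w (n + i) ^ 2 / totalWeight w (n + i) ^ 2)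
      =O[atTop] fun n : ℕ => 1 / (n : ℝ))
    (hb : Tendsto (fun j : ℕ => windowMass w j * exp (E j)) atTop (𝓝 1)) :
    ∀ᵐ ω ∂μ, Tendsto (fun n : ℕ => (treeHeight (fun i => K i ω) n - profile α E 0 (log n)) /
      (log n / (α * log (log n)) ^ 2)) atTop (𝓝 0) := by
  filter_upwards [ae_all_iff.2 fun q : ℕ => hK.ae_eventually_profile_le hE hα hw hw1 hsum hsq hb
      (c := 1 / (q + 1)) (by positivity),
    ae_all_iff.2 fun q : ℕ => hK.ae_eventually_le_profile hE hα hw hw1 hb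
      (c := 1 / (q + 1)) (by positivity)] with ω hlower hupper
  exact tendsto_sub_profile_div hα hlower hupper

end Fluctuation

end WRT

end

theorem theorem1p1_general {Ω : Type*} [MeasurableSpace Ω] (μ : Measure Ω) [IsProbabilityMeasure μ]
    (w : ℕ → ℝ) (hw_nonneg : ∀ i, 1 ≤ i → 0 ≤ w i) (hw_one : 0 < w 1)
    (K : ℕ → Ω → ℕ) (hK : WRT.IsWRT μ w K)
    (α : ℝ) (hα : 0 < α)
    (L : ℝ → ℝ) (hL_pos : ∀ x, 1 ≤ x → 0 < L x) (hL : WRT.SV 1 L)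
    (ha : (fun n : ℕ => WRT.aSeq w n - ∫ x in (1 : ℝ)..Real.log n, x ^ (-α) * L x)
      =o[atTop] fun n : ℕ => Real.log n ^ (-α) * L (Real.log n))
    (hsq_summable : Summable fun i : ℕ => w (i + 1) ^ 2 / WRT.totalWeight w (i + 1) ^ 2)
    (hsq : (fun n : ℕ => ∑' i : ℕ, w (n + i) ^ 2 / WRT.totalWeight w (n + i) ^ 2)
      =O[atTop] fun n : ℕ => 1 / (n : ℝ)) :
    (∀ᶠ n : ℕ in atTop, Summable (WRT.seriesTerm α L n)) ∧
    ∀ᵐ ω ∂μ, ∃ ε : ℕ → ℝ, Tendsto ε atTop (𝓝 0) ∧ ∀ᶠ n : ℕ in atTop,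
      (WRT.treeHeight (fun m => K m ω) n : ℝ) =
        Real.log n / (α * Real.log (Real.log n)) +
        Real.log n / (α * Real.log (Real.log n)) ^ 2 *
          ((∑' k : ℕ, WRT.seriesTerm α L n k) + 1 + α + Real.log α + ε n) := by
  refine ⟨(hL.eventually_abs_log_div_lt_one hL_pos α).mono fun n hratio =>
    (WRT.hasSum_seriesTerm hratio).summable, ?_⟩
  filter_upwards [hK.ae_tendsto_treeHeight_sub_profile_div (hL.logLike_negLogDensity hL_pos α) hα
    hw_nonneg hw_one hsq_summable hsq (hL.tendsto_windowMass_mul_exp hL_pos ha)] with ω hω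
  have tendsto_error := hω.add (hL.tendsto_profile_sub_tsum_seriesTerm hL_pos hα)
  rw [add_zero] at tendsto_error
  refine ⟨_, tendsto_error, ?_⟩
  filter_upwards [WRT.eventually_div_mul_log_log_sq_pos hα] with n scale_pos
  generalize Real.log n / (α * Real.log (Real.log n)) ^ 2 = scale at scale_pos ⊢
  generalize Real.log n / (α * Real.log (Real.log n)) = main
  field_simp
  ring

theorem theorem1p1 {Ω : Type*} [MeasurableSpace Ω] (μ : Measure Ω) [IsProbabilityMeasure μ]
    (w : ℕ → ℝ) (hw_nonneg : ∀ i, 1 ≤ i → 0 ≤ w i) (hw_one : 0 < w 1)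
    (K : ℕ → Ω → ℕ) (hK : WRT.IsWRT μ w K)
    (α : ℝ) (hα : 0 < α)
    (L : ℝ → ℝ) (hL_pos : ∀ x, 1 ≤ x → 0 < L x) (hL : WRT.SV 2 L)
    (ha : (fun n : ℕ => WRT.aSeq w n - ∫ x in (1 : ℝ)..Real.log n, x ^ (-α) * L x)
      =o[atTop] fun n : ℕ =>
        Real.log n ^ (-1 - α) * Real.log (Real.log n) ^ 2 * L (Real.log n))
    (hsq_summable : Summable fun i : ℕ => w (i + 1) ^ 2 / WRT.totalWeight w (i + 1) ^ 2)
    (hsq : (fun n : ℕ => ∑' i : ℕ, w (n + i) ^ 2 / WRT.totalWeight w (n + i) ^ 2)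
      =O[atTop] fun n : ℕ => 1 / (n : ℝ)) :
    (∀ᶠ n : ℕ in atTop, Summable (WRT.seriesTerm α L n)) ∧
    ∀ᵐ ω ∂μ, ∃ ε : ℕ → ℝ, Tendsto ε atTop (𝓝 0) ∧ ∀ᶠ n : ℕ in atTop,
      (WRT.treeHeight (fun m => K m ω) n : ℝ) =
        Real.log n / (α * Real.log (Real.log n)) +
        Real.log n / (α * Real.log (Real.log n)) ^ 2 *
          ((∑' k : ℕ, WRT.seriesTerm α L n k) + 1 + α + Real.log α + ε n) :=
  theorem1p1_general μ w hw_nonneg hw_one K hK α hα L hL_pos (hL.mono one_le_two)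
    (ha.trans ((WRT.isLittleO_rpow_neg_one_sub_mul_log_sq_mul α L).comp_tendsto
      WRT.tendsto_log_natCast)) hsq_summable hsq
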